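/- Let $(\mathbb H,h_1)$ be a separable complex Hilbert space, let $h_2$ be a second Hermitian structure (positive definite Hermitian form) on the same complex vector space, and let the two be related by the bounded operator $G$: $h_2(x,y)=h_1(Gx,y)$ for all $x,y$. Then $G$ is positive and self-adjoint. Let $\Delta\subset\mathbb R$ be its spectrum. A direct integral decomposition of $\mathbb H$ over the spectrum of $G$ consists of a $\sigma$-finite Borel measure $\sigma$ on $\Delta$, a $\sigma$-measurable field of Hilbert spaces $(\mathbb H_\lambda)_{\lambda\in\Delta}$ with $\mathbb H_\lambda\neq 0$ for $\sigma$-almost every $\lambda$, and a unitary identification $\varphi\mapsto(\varphi_\lambda)$ of $(\mathbb H,h_1)$ with $\int_\Delta \mathbb H_\lambda\,d\sigma(\lambda)$ such that $(G\varphi)_\lambda=\lambda\varphi_\lambda$ for $\sigma$-almost every $\lambda$, for all $\varphi$. Such a decomposition exists, even with $\sigma$ finite, and for each such decomposition the following holds. Call a bounded linear operator $U:\mathbb H\to\mathbb H$ bi-unitary if it is bijective and preserves both $h_1$ and $h_2$. (1) $U$ is bi-unitary if and only if it is decomposable with unitary components, that is, $$U\varphi=\int_\Delta U(\lambda)\varphi_\lambda\,d\sigma(\lambda)\qquad(\varphi\in\mathbb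 H)$$ for some measurable field $\lambda\mapsto U(\lambda)$ of unitary operators on $\mathbb H_\lambda$; and every such measurable field defines an operator $U$ in this way. (2) Suppose that $G$ is cyclic, i.e. for some $\psi\in\mathbb H$ the vectors $G^n\psi$, $n\ge 0$, span a dense subspace. Then $\mathbb H_\lambda$ is one-dimensional for $\sigma$-almost every $\lambda$. For each $\sigma$-measurable $\theta:\Delta\to\mathbb R$ the operator $U_\theta\varphi=\int_\Delta e^{i\theta(\lambda)}\varphi_\lambda\,d\sigma(\lambda)$ is defined and is the operator $e^{i\theta(G)}$ of the Borel functional calculus of $G$. The group of bi-unitary operators is exactly $\{U_\theta\}=\{e^{i\theta(G)}\}$, with $\theta$ ranging over the $\sigma$-measurable real functions on $\Delta$. -/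

import Mathlib

open MeasureTheory

universe u v w

noncomputable section

/-- A Hermitian structure on a complex vector space: a positive definite Hermitian form,
conjugate-linear in the first and linear in the second argument. -/
structure HermitianStructure (H : Type u) [AddCommGroup H] [Module ℂ H] where
  form : H →ₗ⋆[ℂ] H →ₗ[ℂ] ℂ
  conj_symm : ∀ x y, starRingEnd ℂ (form y x) = form x y
  pos : ∀ x, x ≠ 0 → 0 < (form x x).re

/-- A (`σ`-)measurable field of Hilbert spaces `l ↦ K l`: a space of measurable vector fields
(sections) which have measurable norm, which is maximal with respect to measurability of inner
products, and which contains a sequence that is total in every fibre. -/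
structure MeasurableField {X : Type w} [MeasurableSpace X] (σ : Measure X) (K : X → Type v)
    [∀ l, NormedAddCommGroup (K l)] [∀ l, InnerProductSpace ℂ (K l)] where
  /-- The measurable sections. -/
  sections : Submodule ℂ (∀ l, K l)
  aemeasurable_norm : ∀ s ∈ sections, AEMeasurable (fun l => ‖s l‖) σ
  mem_of_aemeasurable_inner : ∀ t : ∀ l, K l,
    (∀ s ∈ sections, AEMeasurable (fun l => inner ℂ (s l) (t l)) σ) → t ∈ sections
  exists_total : ∃ e : ℕ → ∀ l, K l, (∀ n, e n ∈ sections) ∧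
    ∀ l, (Submodule.span ℂ (Set.range fun n => e n l)).topologicalClosure = ⊤

namespace MeasurableField

variable {X : Type w} [MeasurableSpace X] {σ : Measure X} {K : X → Type v}
  [∀ l, NormedAddCommGroup (K l)] [∀ l, InnerProductSpace ℂ (K l)]

theorem aemeasurable_inner (F : MeasurableField σ K) {s t : ∀ l, K l}
    (hs : s ∈ F.sections) (ht : t ∈ F.sections) :
    AEMeasurable (fun l => inner ℂ (s l) (t l)) σ := by
  have h1 := F.aemeasurable_norm _ (F.sections.add_mem hs ht)
  have h2 := F.aemeasurable_norm _ (F.sections.sub_mem hs ht)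
  have h3 := F.aemeasurable_norm _
    (F.sections.sub_mem hs (F.sections.smul_mem Complex.I ht))
  have h4 := F.aemeasurable_norm _
    (F.sections.add_mem hs (F.sections.smul_mem Complex.I ht))
  simp only [Pi.add_apply, Pi.sub_apply, Pi.smul_apply] at h1 h2 h3 h4
  simp only [inner_eq_sum_norm_sq_div_four, RCLike.I_to_complex]
  have c1 := Complex.measurable_ofReal.comp_aemeasurable h1
  have c2 := Complex.measurable_ofReal.comp_aemeasurable h2
  have c3 := Complex.measurable_ofReal.comp_aemeasurable h3
  have c4 := Complex.measurable_ofReal.comp_aemeasurable h4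
  exact ((((c1.pow_const 2).sub (c2.pow_const 2)).add
    (((c3.pow_const 2).sub (c4.pow_const 2)).mul_const Complex.I)).div_const 4)

/-- The square-integrable measurable sections. -/
def squareIntegrable (F : MeasurableField σ K) : Submodule ℂ (∀ l, K l) where
  carrier := {s | s ∈ F.sections ∧ MemLp (fun l => ‖s l‖) 2 σ}
  add_mem' := by
    rintro s t ⟨hs, hs2⟩ ⟨ht, ht2⟩
    refine ⟨F.sections.add_mem hs ht, (hs2.add ht2).mono
      (F.aemeasurable_norm _ (F.sections.add_mem hs ht)).aestronglyMeasurable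
      (Filter.Eventually.of_forall fun l => ?_)⟩
    simp only [Pi.add_apply, norm_norm]
    exact (norm_add_le _ _).trans (le_abs_self _)
  zero_mem' := ⟨F.sections.zero_mem, by simp⟩
  smul_mem' := by
    rintro c s ⟨hs, hs2⟩
    refine ⟨F.sections.smul_mem c hs, ?_⟩
    simpa [norm_smul] using hs2.const_mul ‖c‖

/-- The square-integrable measurable sections, as a type of its own carrying the
seminorm `(∫ ‖s l‖² dσ)^(1/2)`. -/
def PreDirectIntegral (F : MeasurableField σ K) : Type (max v w) := ↥F.squareIntegrable

variable (F : MeasurableField σ K)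

instance : AddCommGroup F.PreDirectIntegral := inferInstanceAs (AddCommGroup ↥F.squareIntegrable)

instance : Module ℂ F.PreDirectIntegral := inferInstanceAs (Module ℂ ↥F.squareIntegrable)

theorem integrable_inner (s t : F.PreDirectIntegral) :
    Integrable (fun l => inner ℂ (s.1 l) (t.1 l)) σ := by
  refine (s.2.2.integrable_mul t.2.2).mono
    (F.aemeasurable_inner s.2.1 t.2.1).aestronglyMeasurable
    (Filter.Eventually.of_forall fun l => ?_)
  simpa using norm_inner_le_norm (𝕜 := ℂ) (s.1 l) (t.1 l)

/-- The inner product `∫ ⟪s l, t l⟫ dσ(l)`. -/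
@[reducible]
def preCore : PreInnerProductSpace.Core ℂ F.PreDirectIntegral where
  inner s t := ∫ l, inner ℂ (s.1 l) (t.1 l) ∂σ
  conj_inner_symm s t := by
    rw [← integral_conj]
    simp only [inner_conj_symm]
  re_inner_nonneg s := by
    have h := integral_re (F.integrable_inner s s)
    rw [← h]
    exact integral_nonneg fun l => inner_self_nonneg
  add_left r s t := by
    rw [← integral_add (F.integrable_inner r t) (F.integrable_inner s t)]
    exact integral_congr_ae (Filter.Eventually.of_forall fun l =>
      inner_add_left (r.1 l) (s.1 l) (t.1 l))
  smul_left s t c := by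
    rw [← integral_const_mul]
    exact integral_congr_ae (Filter.Eventually.of_forall fun l =>
      inner_smul_left (s.1 l) (t.1 l) c)

instance : SeminormedAddCommGroup F.PreDirectIntegral :=
  letI := F.preCore
  InnerProductSpace.Core.toSeminormedAddCommGroup (𝕜 := ℂ)

instance : InnerProductSpace ℂ F.PreDirectIntegral :=
  InnerProductSpace.ofCore F.preCore

/-- The direct integral `∫ K l dσ(l)`: square-integrable measurable sections, two sections being
identified when their difference has seminorm `0`, that is, when they agree `σ`-almost
everywhere. -/
abbrev DirectIntegral : Type (max v w) := SeparationQuotient F.PreDirectIntegral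

/-- The components `l ↦ φ l` of an element `φ` of the direct integral (a representative
section, unique up to `σ`-almost everywhere equality). -/
def DirectIntegral.component {F : MeasurableField σ K} (φ : F.DirectIntegral) : ∀ l, K l :=
  (Function.surjInv SeparationQuotient.surjective_mk φ : F.PreDirectIntegral).1

/-- A measurable field of unitary operators on the fibres. -/
def IsMeasurableUnitaryField (V : ∀ l, K l ≃ₗᵢ[ℂ] K l) : Prop :=
  ∀ s ∈ F.sections, (fun l => V l (s l)) ∈ F.sections

end MeasurableField

/-- A direct integral decomposition `H = ∫ K l dσ(l)` of the Hilbert space `H` over the spectrum of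
`G`, with nonzero fibres `K l`, in which `G` acts as multiplication by the spectral variable. -/
structure SpectralDecomposition {H : Type u} [NormedAddCommGroup H] [InnerProductSpace ℂ H]
    [CompleteSpace H] (G : H →L[ℂ] H) where
  σ : Measure (spectrum ℝ G)
  sigmaFinite : SigmaFinite σ
  /-- The component Hilbert spaces. -/
  K : spectrum ℝ G → Type v
  [normed : ∀ l, NormedAddCommGroup (K l)]
  [innerProduct : ∀ l, InnerProductSpace ℂ (K l)]
  [complete : ∀ l, CompleteSpace (K l)]
  nontrivial : ∀ᵐ l ∂σ, Nontrivial (K l)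
  field : MeasurableField σ K
  /-- The unitary identification of `H` with the direct integral. -/
  W : H ≃ₗᵢ[ℂ] field.DirectIntegral
  mul_apply : ∀ φ, ∀ᵐ l ∂σ, (W (G φ)).component l = ((l : ℝ) : ℂ) • (W φ).component l

namespace SpectralDecomposition

attribute [instance] sigmaFinite normed innerProduct complete

variable {H : Type u} [NormedAddCommGroup H] [InnerProductSpace ℂ H] [CompleteSpace H]
  {G : H →L[ℂ] H}

/-- The component `φ_l` of `φ : H` in the fibre over `l`. -/
def component (D : SpectralDecomposition.{u, v} G) (φ : H) (l : spectrum ℝ G) : D.K l :=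
  (D.W φ).component l

/-- `U` is the decomposable operator `φ ↦ ∫ V(l) φ_l dσ(l)`. -/
def IsDecomposed (D : SpectralDecomposition.{u, v} G) (V : ∀ l, D.K l ≃ₗᵢ[ℂ] D.K l)
    (U : H →L[ℂ] H) : Prop :=
  ∀ φ, ∀ᵐ l ∂D.σ, D.component (U φ) l = V l (D.component φ l)

/-- `U` is the operator `φ ↦ ∫ e^{iθ(l)} φ_l dσ(l)`. -/
def IsPhaseMultiplication (D : SpectralDecomposition.{u, v} G) (θ : spectrum ℝ G → ℝ)
    (U : H →L[ℂ] H) : Prop :=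
  ∀ φ, ∀ᵐ l ∂D.σ, D.component (U φ) l = Complex.exp (Complex.I * θ l) • D.component φ l

end SpectralDecomposition

section Operators

variable {H : Type u} [NormedAddCommGroup H] [InnerProductSpace ℂ H]

/-- `U` is unitary for the Hilbert space structure of `H` and for the Hermitian structure `h`. -/
def IsBiUnitary (h : HermitianStructure H) (U : H →L[ℂ] H) : Prop :=
  Function.Bijective U ∧ (∀ x y, inner ℂ (U x) (U y) = inner ℂ x y) ∧
    ∀ x y, h.form (U x) (U y) = h.form x y

/-- `G` is cyclic: the powers of `G` applied to some vector span a dense subspace. -/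
def IsCyclicOperator (G : H →L[ℂ] H) : Prop :=
  ∃ ψ : H, (Submodule.span ℂ (Set.range fun n : ℕ => (G ^ n) ψ)).topologicalClosure = ⊤

variable [CompleteSpace H]

/-- `μ` is the spectral measure `⟪x, E_G(·) x⟫` of the bounded self-adjoint operator `G` in the
vector `x`: the finite Borel measure on the (compact) spectrum with moments `⟪x, G ^ n x⟫`. -/
def IsSpectralMeasureAt (G : H →L[ℂ] H) (x : H) (μ : Measure (spectrum ℝ G)) : Prop :=
  IsFiniteMeasure μ ∧ ∀ n : ℕ, ∫ l, ((l : ℝ) : ℂ) ^ n ∂μ = inner ℂ x ((G ^ n) x)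

/-- `T = f(G)` in the Borel functional calculus of the bounded self-adjoint operator `G`
(for bounded `f`): `⟪x, T x⟫ = ∫ f d⟪x, E_G(·) x⟫` for all `x`. -/
def IsFunctionOf (G : H →L[ℂ] H) (f : spectrum ℝ G → ℂ) (T : H →L[ℂ] H) : Prop :=
  ∀ x, ∃ μ, IsSpectralMeasureAt G x μ ∧ Integrable f μ ∧ inner ℂ x (T x) = ∫ l, f l ∂μ

end Operators

end

/-!
The proof rests on two facts: a finite measure on a compact subset of the line is determined by its
moments (`measure_eq_of_moments_eq`, by Stone–Weierstrass), and two total families with equal Gram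
matrices correspond under a unitary operator (`exists_linearIsometryEquiv_of_inner_eq`).

In a decomposition over the spectrum, `⟪x, G ^ n y⟫` is the `n`-th moment of `l ↦ ⟪x l, y l⟫`, so
the fibrewise inner products are determined almost everywhere by these numbers
(`SpectralDecomposition.ae_inner_eq_of_inner_pow_eq`). A bi-unitary operator `U` commutes with `G`,
because it preserves both `⟪x, y⟫` and `⟪G x, y⟫`. Hence `U` preserves almost all fibrewise inner
products, and the Gram matrix lemma, applied in each fibre to a sequence of vectors and its image
under `U`, gives the unitary operators `V(l)` (`IsBiUnitary.exists_isDecomposed`). In the other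
direction, a decomposed operator is an isometry commuting with multiplication by `l`, and it is
inverted by the field of the inverses, which is measurable by maximality of the space of
measurable sections.

If `ψ` is cyclic, the part of a section fibrewise orthogonal to `ψ` is orthogonal to all `G ^ n ψ`,
hence zero, so that the fibres are spanned by the components of `ψ`
(`SpectralDecomposition.component_eq_smul_of_cyclic`). The unitary operators on the fibres are then
multiplications by `e^{iθ(l)}`, with `θ(l)` the argument of `⟪ψ l, (U ψ) l⟫`. The spectral measure
of `G` in `x` is `‖x l‖² dσ(l)`, again by uniqueness of moments, and this identifies the
multiplications by `e^{iθ}` with the operators `e^{iθ(G)}`.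

Existence of a decomposition (`exists_spectralDecomposition`): the Riesz–Markov–Kakutani theorem
applied to `f ↦ ⟪x, f(G) x⟫` gives the spectral measures, and a Gram–Schmidt procedure gives vectors
`x n` which generate orthogonal cyclic subspaces with dense sum. With respect to a finite measure
`σ` dominating the spectral measures of the `x n`, with densities `ρ n`, the fibre over `l` is the
space of square-summable sequences supported on `{n | ρ n l ≠ 0}`. The Gram matrix lemma, applied
to the vectors `G ^ k x n` and the sections `l ↦ l ^ k √(ρ n l) e n`, gives the unitary
identification; it needs the completeness of direct integrals
(`MeasurableField.instCompleteSpaceDirectIntegral`).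
-/

noncomputable section

/-! ### Moments of measures on a compact subset of the line -/

section Moments

variable {s : Set ℝ}

theorem continuous_coe_pow_complex (n : ℕ) : Continuous fun l : s => ((l : ℝ) : ℂ) ^ n := by
  fun_prop

variable [CompactSpace s]

theorem norm_coe_pow_le (n : ℕ) : ∃ C : ℝ, ∀ l : s, ‖((l : ℝ) : ℂ) ^ n‖ ≤ C := by
  obtain ⟨C, hC⟩ := (isCompact_univ (X := s)).exists_bound_of_continuousOn
    (continuous_coe_pow_complex n).continuousOn
  exact ⟨C, fun l => hC l trivial⟩

theorem integrable_coe_pow_mul {μ : Measure s} {g : s → ℂ} (hg : Integrable g μ) (n : ℕ) :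
    Integrable (fun l : s => ((l : ℝ) : ℂ) ^ n * g l) μ := by
  obtain ⟨C, hC⟩ := norm_coe_pow_le (s := s) n
  exact hg.bdd_mul (c := C) (continuous_coe_pow_complex n).aestronglyMeasurable
    (Filter.Eventually.of_forall hC)

/-- The moment problem on a compact set is determinate, by Stone–Weierstrass. -/
theorem measure_eq_of_moments_eq {μ ν : Measure s} [IsFiniteMeasure μ] [IsFiniteMeasure ν]
    (h : ∀ n : ℕ, ∫ l, ((l : ℝ) : ℂ) ^ n ∂μ = ∫ l, ((l : ℝ) : ℂ) ^ n ∂ν) : μ = ν := by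
  have hre : ∀ n : ℕ, ∫ l, (l : ℝ) ^ n ∂μ = ∫ l, (l : ℝ) ^ n ∂ν := fun n => by
    have := h n
    simp only [← Complex.ofReal_pow] at this
    rwa [integral_complex_ofReal, integral_complex_ofReal, Complex.ofReal_inj] at this
  have hint : ∀ (κ : Measure s) [IsFiniteMeasure κ] (f : C(s, ℝ)), Integrable f κ :=
    fun κ _ f => f.continuous.integrable_of_hasCompactSupport (HasCompactSupport.of_compactSpace f)
  have hcont : ∀ (κ : Measure s) [IsFiniteMeasure κ],
      Continuous fun f : C(s, ℝ) => ∫ l, f l ∂κ := by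
    intro κ _
    refine continuous_iff_continuousAt.2 fun f => ?_
    refine tendsto_integral_filter_of_dominated_convergence (fun _ => ‖f‖ + 1)
      (Filter.Eventually.of_forall fun g => g.continuous.aestronglyMeasurable) ?_
      (integrable_const _)
      (Filter.Eventually.of_forall fun l => (continuous_eval_const l).tendsto f)
    filter_upwards [Metric.ball_mem_nhds f one_pos] with g hg
    refine Filter.Eventually.of_forall fun l => (g.norm_coe_le_norm l).trans ?_
    have := norm_sub_norm_le g f
    rw [Metric.mem_ball, dist_eq_norm] at hg
    linarith
  have hpoly : ∀ p : Polynomial ℝ, ∫ l, p.eval (l : ℝ) ∂μ = ∫ l, p.eval (l : ℝ) ∂ν := by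
    intro p
    simp only [Polynomial.eval_eq_sum_range]
    have hi : ∀ (κ : Measure s) [IsFiniteMeasure κ] (i : ℕ),
        Integrable (fun l : s => p.coeff i * (l : ℝ) ^ i) κ := fun κ _ i =>
      hint κ ⟨fun l : s => p.coeff i * (l : ℝ) ^ i, by fun_prop⟩
    rw [integral_finsetSum _ fun i _ => hi μ i, integral_finsetSum _ fun i _ => hi ν i]
    simp only [integral_const_mul, hre]
  have hall : ∀ f : C(s, ℝ), ∫ l, f l ∂μ = ∫ l, f l ∂ν := by
    intro f
    have hf : f ∈ (polynomialFunctions s).topologicalClosure := by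
      rw [ContinuousMap.subalgebra_topologicalClosure_eq_top_of_separatesPoints _
        (polynomialFunctions_separatesPoints s)]
      trivial
    rw [← SetLike.mem_coe, Subalgebra.topologicalClosure_coe] at hf
    refine closure_minimal ?_ (isClosed_eq (hcont μ) (hcont ν)) hf
    rintro g ⟨p, -, rfl⟩
    exact hpoly p
  exact ext_of_forall_integral_eq_of_IsFiniteMeasure fun f => hall f.toContinuousMap

theorem ae_eq_zero_of_real_moments_eq_zero {σ : Measure s} {g : s → ℝ} (hg : Integrable g σ)
    (h : ∀ n : ℕ, ∫ l, (l : ℝ) ^ n * g l ∂σ = 0) : g =ᵐ[σ] 0 := by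
  -- The positive and the negative part of `g` are densities of finite measures with equal moments.
  have hfin : ∀ f : s → ℝ, Integrable f σ →
      IsFiniteMeasure (σ.withDensity fun l => ENNReal.ofReal (f l)) :=
    fun f hf => isFiniteMeasure_withDensity_ofReal hf.2
  have hm : ∀ f : s → ℝ, Integrable f σ → ∀ n : ℕ,
      ∫ l, ((l : ℝ) : ℂ) ^ n ∂(σ.withDensity fun l => ENNReal.ofReal (f l)) =
        ((∫ l, (l : ℝ) ^ n * max (f l) 0 ∂σ : ℝ) : ℂ) := by
    intro f hf n
    rw [integral_withDensity_eq_integral_toReal_smul₀ hf.1.aemeasurable.ennreal_ofReal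
      (Filter.Eventually.of_forall fun _ => ENNReal.ofReal_lt_top), ← integral_complex_ofReal]
    refine integral_congr_ae (Filter.Eventually.of_forall fun l => ?_)
    simp [ENNReal.toReal_ofReal', mul_comm]
  have hbdd : ∀ f : s → ℝ, Integrable f σ → ∀ n : ℕ,
      Integrable (fun l : s => (l : ℝ) ^ n * f l) σ := by
    intro f hf n
    have := (integrable_coe_pow_mul (hf.ofReal (𝕜 := ℂ)) n).re
    refine this.congr (Filter.Eventually.of_forall fun l => ?_)
    simp [← Complex.ofReal_pow, ← Complex.ofReal_mul]
  have := hfin g hg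
  have := hfin (-g) hg.neg
  have hp : Integrable (fun l => max (g l) 0) σ := hg.pos_part
  have hn : Integrable (fun l => max (-g l) 0) σ := hg.neg.pos_part
  have heq : σ.withDensity (fun l => ENNReal.ofReal (g l)) =
      σ.withDensity (fun l => ENNReal.ofReal ((-g) l)) := by
    refine measure_eq_of_moments_eq fun n => ?_
    rw [hm g hg, hm (-g) hg.neg]
    congr 1
    rw [← sub_eq_zero]
    refine (integral_sub (hbdd _ hp n) (hbdd _ hn n)).symm.trans (Eq.trans ?_ (h n))
    refine integral_congr_ae (Filter.Eventually.of_forall fun l => ?_)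
    rcases le_total (g l) 0 with h0 | h0
    · simp [max_eq_right h0, max_eq_left (neg_nonneg.2 h0)]
    · simp [max_eq_left h0, max_eq_right (neg_nonpos.2 h0)]
  have hae := (withDensity_eq_iff hg.1.aemeasurable.ennreal_ofReal
    hg.neg.1.aemeasurable.ennreal_ofReal (by
      have := measure_lt_top (σ.withDensity fun l => ENNReal.ofReal (g l)) Set.univ
      rw [withDensity_apply _ MeasurableSet.univ, Measure.restrict_univ] at this
      exact this.ne)).1 heq
  filter_upwards [hae] with l hl
  simp only [Pi.neg_apply] at hl
  rcases le_total (g l) 0 with h0 | h0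
  · rw [ENNReal.ofReal_of_nonpos h0, eq_comm, ENNReal.ofReal_eq_zero] at hl
    simp; linarith
  · rw [ENNReal.ofReal_of_nonpos (neg_nonpos.2 h0), ENNReal.ofReal_eq_zero] at hl
    simp; linarith

/-- An integrable function on a compact subset of the line is determined by its moments. -/
theorem ae_eq_of_moments_eq {σ : Measure s} {f g : s → ℂ} (hf : Integrable f σ)
    (hg : Integrable g σ)
    (h : ∀ n : ℕ, ∫ l, ((l : ℝ) : ℂ) ^ n * f l ∂σ = ∫ l, ((l : ℝ) : ℂ) ^ n * g l ∂σ) :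
    f =ᵐ[σ] g := by
  have hd := hf.sub hg
  have h0 : ∀ n : ℕ, ∫ l, ((l : ℝ) : ℂ) ^ n * (f - g) l ∂σ = 0 := fun n => by
    simp only [Pi.sub_apply, mul_sub]
    exact (integral_sub (integrable_coe_pow_mul hf n) (integrable_coe_pow_mul hg n)).trans
      (sub_eq_zero.2 (h n))
  have hre := ae_eq_zero_of_real_moments_eq_zero (g := fun l => ((f - g) l).re) hd.re fun n => by
    have := integral_re (integrable_coe_pow_mul hd n)
    rw [h0 n] at this
    rw [← Complex.zero_re]
    refine Eq.trans (integral_congr_ae (Filter.Eventually.of_forall fun l => ?_)) this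
    simp [← Complex.ofReal_pow]
  have him := ae_eq_zero_of_real_moments_eq_zero (g := fun l => ((f - g) l).im) hd.im fun n => by
    have := integral_im (integrable_coe_pow_mul hd n)
    rw [h0 n] at this
    rw [← Complex.zero_im]
    refine Eq.trans (integral_congr_ae (Filter.Eventually.of_forall fun l => ?_)) this
    simp [← Complex.ofReal_pow]
  filter_upwards [hre, him] with l h1 h2
  exact sub_eq_zero.1 (Complex.ext h1 h2)

end Moments

/-! ### Total families with equal Gram matrices -/

section Gram

variable {ι : Type*} {E F : Type*} [NormedAddCommGroup E] [InnerProductSpace ℂ E]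
  [NormedAddCommGroup F] [InnerProductSpace ℂ F]

theorem eq_zero_of_forall_inner_eq_zero {f : ι → E}
    (hf : (Submodule.span ℂ (Set.range f)).topologicalClosure = ⊤) {x : E}
    (hx : ∀ i, inner ℂ (f i) x = 0) : x = 0 := by
  have hle : Submodule.span ℂ (Set.range f) ≤ (ℂ ∙ x)ᗮ := by
    rw [Submodule.span_le]
    rintro _ ⟨i, rfl⟩
    exact Submodule.mem_orthogonal_singleton_iff_inner_left.2 (hx i)
  have hmem : x ∈ (ℂ ∙ x)ᗮ :=
    Submodule.topologicalClosure_minimal _ hle (Submodule.isClosed_orthogonal _)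
      (hf ▸ Submodule.mem_top)
  exact inner_self_eq_zero.1 (Submodule.mem_orthogonal_singleton_iff_inner_left.1 hmem)

theorem denseRange_linearCombination {f : ι → E}
    (hf : (Submodule.span ℂ (Set.range f)).topologicalClosure = ⊤) :
    DenseRange (Finsupp.linearCombination ℂ f) := by
  rw [DenseRange, ← LinearMap.coe_range, Finsupp.range_linearCombination]
  exact Submodule.dense_iff_topologicalClosure_eq_top.2 hf

/-- Two total families with the same Gram matrix correspond to each other under a unitary
operator. -/
theorem exists_linearIsometryEquiv_of_inner_eq [CompleteSpace E] [CompleteSpace F]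
    {f : ι → E} {g : ι → F}
    (hf : (Submodule.span ℂ (Set.range f)).topologicalClosure = ⊤)
    (hg : (Submodule.span ℂ (Set.range g)).topologicalClosure = ⊤)
    (h : ∀ i j, inner ℂ (f i) (f j) = inner ℂ (g i) (g j)) :
    ∃ V : E ≃ₗᵢ[ℂ] F, ∀ i, V (f i) = g i := by
  have hnorm : ∀ c : ι →₀ ℂ,
      ‖Finsupp.linearCombination ℂ g c‖ = ‖Finsupp.linearCombination ℂ f c‖ := by
    intro c
    rw [@norm_eq_sqrt_re_inner ℂ, @norm_eq_sqrt_re_inner ℂ]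
    simp only [Finsupp.linearCombination_apply, Finsupp.sum, sum_inner, inner_sum,
      inner_smul_left, inner_smul_right, h]
  refine ⟨(LinearEquiv.refl ℂ (ι →₀ ℂ)).extendOfIsometry (Finsupp.linearCombination ℂ f)
    (Finsupp.linearCombination ℂ g) (denseRange_linearCombination hf)
    (denseRange_linearCombination hg) hnorm, fun i => ?_⟩
  have := LinearEquiv.extendOfIsometry_eq (LinearEquiv.refl ℂ (ι →₀ ℂ)) _ _
    (denseRange_linearCombination hf)
    (denseRange_linearCombination hg) hnorm (Finsupp.single i 1)
  simpa using this

end Gram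

/-! ### Measurable fields and their direct integrals -/

namespace MeasurableField

variable {X : Type w} [MeasurableSpace X] {σ : Measure X} {K : X → Type v}
  [∀ l, NormedAddCommGroup (K l)] [∀ l, InnerProductSpace ℂ (K l)] {F : MeasurableField σ K}

theorem mem_sections_congr_ae {s t : ∀ l, K l} (hs : s ∈ F.sections) (h : ∀ᵐ l ∂σ, s l = t l) :
    t ∈ F.sections :=
  F.mem_of_aemeasurable_inner t fun r hr =>
    (F.aemeasurable_inner hr hs).congr (h.mono fun l hl => by simp only [hl])

theorem smul_mem_sections {c : X → ℂ} (hc : AEMeasurable c σ) {s : ∀ l, K l}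
    (hs : s ∈ F.sections) : (fun l => c l • s l) ∈ F.sections :=
  F.mem_of_aemeasurable_inner _ fun r hr => by
    simp only [inner_smul_right]
    exact hc.mul (F.aemeasurable_inner hr hs)

theorem mem_sections_of_tendsto_ae {s : ℕ → ∀ l, K l} {t : ∀ l, K l}
    (hs : ∀ n, s n ∈ F.sections)
    (h : ∀ᵐ l ∂σ, Filter.Tendsto (fun n => s n l) Filter.atTop (nhds (t l))) : t ∈ F.sections :=
  F.mem_of_aemeasurable_inner _ fun _ hr =>
    aemeasurable_of_tendsto_metrizable_ae Filter.atTop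
      (fun n => F.aemeasurable_inner hr (hs n)) (h.mono fun _ hl => tendsto_const_nhds.inner hl)

theorem mem_squareIntegrable_of_norm_le {s : ∀ l, K l} (hs : s ∈ F.sections) {f : X → ℝ}
    (hf : MemLp f 2 σ) (h : ∀ᵐ l ∂σ, ‖s l‖ ≤ f l) : s ∈ F.squareIntegrable :=
  ⟨hs, hf.mono (F.aemeasurable_norm _ hs).aestronglyMeasurable
    (h.mono fun l hl => by simpa using hl.trans (le_abs_self _))⟩

/-- The class of a square-integrable section in the direct integral. -/
def toDirect {s : ∀ l, K l} (hs : s ∈ F.squareIntegrable) : F.DirectIntegral :=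
  SeparationQuotient.mk (⟨s, hs⟩ : F.squareIntegrable)

theorem component_mem (φ : F.DirectIntegral) : φ.component ∈ F.squareIntegrable :=
  (Function.surjInv SeparationQuotient.surjective_mk φ : F.PreDirectIntegral).2

@[simp]
theorem toDirect_component (φ : F.DirectIntegral) : toDirect (component_mem φ) = φ :=
  Function.surjInv_eq SeparationQuotient.surjective_mk φ

theorem inner_toDirect {s t : ∀ l, K l} (hs : s ∈ F.squareIntegrable)
    (ht : t ∈ F.squareIntegrable) :
    inner ℂ (toDirect hs) (toDirect ht) = ∫ l, inner ℂ (s l) (t l) ∂σ := rfl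

theorem inner_eq (φ ψ : F.DirectIntegral) :
    inner ℂ φ ψ = ∫ l, inner ℂ (φ.component l) (ψ.component l) ∂σ := by
  conv_lhs => rw [← toDirect_component φ, ← toDirect_component ψ]
  exact inner_toDirect _ _

theorem integrable_inner_component (φ ψ : F.DirectIntegral) :
    Integrable (fun l => inner ℂ (φ.component l) (ψ.component l)) σ :=
  F.integrable_inner (⟨_, component_mem φ⟩ : F.squareIntegrable)
    (⟨_, component_mem ψ⟩ : F.squareIntegrable)

theorem norm_toDirect {s : ∀ l, K l} (hs : s ∈ F.squareIntegrable) :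
    ‖toDirect hs‖ = ‖hs.2.toLp‖ := by
  rw [@norm_eq_sqrt_re_inner ℂ, @norm_eq_sqrt_re_inner ℝ, inner_toDirect, L2.inner_def]
  congr 1
  have h1 : ∫ l, inner ℂ (s l) (s l) ∂σ = ((∫ l, ‖s l‖ ^ 2 ∂σ : ℝ) : ℂ) := by
    rw [← integral_complex_ofReal]
    exact integral_congr_ae (Filter.Eventually.of_forall fun l => by
      simp [inner_self_eq_norm_sq_to_K])
  rw [h1]
  simp only [RCLike.re_to_complex, Complex.ofReal_re, RCLike.re_to_real]
  refine integral_congr_ae ?_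
  filter_upwards [hs.2.coeFn_toLp] with l hl
  rw [hl]
  simp

theorem toDirect_add {s t : ∀ l, K l} (hs : s ∈ F.squareIntegrable) (ht : t ∈ F.squareIntegrable) :
    toDirect (F.squareIntegrable.add_mem hs ht) = toDirect hs + toDirect ht := rfl

theorem toDirect_sub {s t : ∀ l, K l} (hs : s ∈ F.squareIntegrable) (ht : t ∈ F.squareIntegrable) :
    toDirect (F.squareIntegrable.sub_mem hs ht) = toDirect hs - toDirect ht := rfl

theorem toDirect_smul (c : ℂ) {s : ∀ l, K l} (hs : s ∈ F.squareIntegrable) :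
    toDirect (F.squareIntegrable.smul_mem c hs) = c • toDirect hs := rfl

theorem toDirect_sum {ι : Type*} (I : Finset ι) {s : ι → ∀ l, K l}
    (hs : ∀ i, s i ∈ F.squareIntegrable) :
    toDirect (F.squareIntegrable.sum_mem fun i (_ : i ∈ I) => hs i) = ∑ i ∈ I, toDirect (hs i) := by
  classical
  induction I using Finset.induction_on with
  | empty => rfl
  | insert a I ha ih =>
    rw [Finset.sum_insert (f := fun i => toDirect (hs i)) ha, ← ih, ← toDirect_add]
    congr 1
    exact Finset.sum_insert ha

theorem toDirect_eq_iff {s t : ∀ l, K l} (hs : s ∈ F.squareIntegrable)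
    (ht : t ∈ F.squareIntegrable) : toDirect hs = toDirect ht ↔ ∀ᵐ l ∂σ, s l = t l := by
  rw [← sub_eq_zero, ← toDirect_sub, ← norm_eq_zero, norm_toDirect, norm_eq_zero,
    Lp.eq_zero_iff_ae_eq_zero]
  refine Filter.eventually_congr ?_
  filter_upwards [(F.squareIntegrable.sub_mem hs ht).2.coeFn_toLp] with l hl
  rw [hl]
  simp [sub_eq_zero]

theorem component_toDirect {s : ∀ l, K l} (hs : s ∈ F.squareIntegrable) :
    ∀ᵐ l ∂σ, (toDirect hs).component l = s l :=
  (toDirect_eq_iff _ hs).1 (toDirect_component _)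

theorem ext_component {φ ψ : F.DirectIntegral}
    (h : ∀ᵐ l ∂σ, φ.component l = ψ.component l) : φ = ψ := by
  rw [← toDirect_component φ, ← toDirect_component ψ]
  exact (toDirect_eq_iff _ _).2 h

theorem component_add (φ ψ : F.DirectIntegral) :
    ∀ᵐ l ∂σ, (φ + ψ).component l = φ.component l + ψ.component l := by
  have h := component_toDirect (F.squareIntegrable.add_mem (component_mem φ) (component_mem ψ))
  rwa [toDirect_add (component_mem φ) (component_mem ψ), toDirect_component,
    toDirect_component] at h

theorem component_smul (c : ℂ) (φ : F.DirectIntegral) :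
    ∀ᵐ l ∂σ, (c • φ).component l = c • φ.component l := by
  have h := component_toDirect (F.squareIntegrable.smul_mem c (component_mem φ))
  rwa [toDirect_smul c (component_mem φ), toDirect_component] at h

/-- The Riesz–Fischer theorem for direct integrals: an absolutely summable series of sections
converges almost everywhere, and its pointwise sum is its sum in the direct integral. -/
instance instCompleteSpaceDirectIntegral [∀ l, CompleteSpace (K l)] :
    CompleteSpace F.DirectIntegral := by
  refine NormedAddCommGroup.completeSpace_of_summable_imp_tendsto fun u hu => ?_
  let f : ℕ → Lp ℝ 2 σ := fun n => (component_mem (u n)).2.toLp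
  have hnorm : ∀ n, ‖f n‖ = ‖u n‖ := fun n =>
    (norm_toDirect (component_mem (u n))).symm.trans (by rw [toDirect_component])
  have hsum : Summable f := Summable.of_norm (by simpa only [hnorm] using hu)
  have hsum' : ∑' n, ‖f n‖ₑ ≠ ⊤ := by
    rw [tsum_enorm_ne_top_iff_summable_norm]
    simpa only [hnorm] using hu
  have hf : ∀ᵐ l ∂σ, ∀ n, f n l = ‖(u n).component l‖ :=
    ae_all_iff.2 fun n => (component_mem (u n)).2.coeFn_toLp
  have hpt : ∀ᵐ l ∂σ, HasSum (fun n => ‖(u n).component l‖) ((∑' n, f n : Lp ℝ 2 σ) l) := by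
    filter_upwards [Lp.hasSum_coeFn_tsum hsum', hf] with l h1 h2
    simpa only [h2] using h1
  -- Where the norms are not summable the sum is a junk value, on a null set by `hpt`.
  let t : ∀ l, K l := fun l => ∑' n, (u n).component l
  have htmem : t ∈ F.sections := by
    refine mem_sections_of_tendsto_ae
      (s := fun N => ∑ n ∈ Finset.range N, (u n).component)
      (fun N => F.sections.sum_mem fun n _ => (component_mem (u n)).1) ?_
    filter_upwards [hpt] with l hl
    simpa only [Finset.sum_apply] using (Summable.of_norm hl.summable).hasSum.tendsto_sum_nat
  have ht : t ∈ F.squareIntegrable := by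
    refine mem_squareIntegrable_of_norm_le htmem (Lp.memLp (∑' n, f n)) ?_
    filter_upwards [hpt] with l hl
    exact (norm_tsum_le_tsum_norm hl.summable).trans_eq hl.tsum_eq
  refine ⟨toDirect ht, tendsto_iff_norm_sub_tendsto_zero.2 ?_⟩
  have hlim := tendsto_iff_norm_sub_tendsto_zero.1 hsum.hasSum.tendsto_sum_nat
  refine squeeze_zero (fun _ => norm_nonneg _) (fun N => ?_) hlim
  have hN : ∑ n ∈ Finset.range N, u n =
      toDirect (F.squareIntegrable.sum_mem fun n (_ : n ∈ Finset.range N) =>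
        component_mem (u n)) := by
    rw [toDirect_sum _ fun n => component_mem (u n)]
    simp only [toDirect_component]
  rw [hN, ← toDirect_sub, norm_toDirect]
  refine Lp.norm_le_norm_of_ae_le ?_
  filter_upwards [hpt, hf, MemLp.coeFn_toLp (F.squareIntegrable.sub_mem
    (F.squareIntegrable.sum_mem fun n (_ : n ∈ Finset.range N) => component_mem (u n)) ht).2,
    Lp.coeFn_sub (∑ n ∈ Finset.range N, f n) (∑' n, f n),
    Lp.coeFn_fun_finsetSum (Finset.range N) f] with l h1 h2 h3 h4 h5
  rw [h3, h4, Pi.sub_apply (⇑(∑ n ∈ Finset.range N, f n)), h5]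
  have hs := Summable.of_norm h1.summable
  have e1 : (∑ n ∈ Finset.range N, (u n).component - t) l =
      -∑' n, (u (n + N)).component l := by
    have ht' : t l = _ := (hs.sum_add_tsum_nat_add N).symm
    rw [Pi.sub_apply, Finset.sum_apply, ht', sub_add_cancel_left]
  have e2 : ∑ n ∈ Finset.range N, f n l - (∑' n, f n : Lp ℝ 2 σ) l =
      -∑' n, ‖(u (n + N)).component l‖ := by
    rw [← h1.tsum_eq, ← h1.summable.sum_add_tsum_nat_add N]
    simp [h2]
  rw [e1, e2, norm_neg, norm_neg, norm_norm]
  have htail : Summable fun n => ‖(u (n + N)).component l‖ :=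
    (summable_nat_add_iff (f := fun n => ‖(u n).component l‖) N).2 h1.summable
  exact (norm_tsum_le_tsum_norm htail).trans (le_abs_self _)

/-- Every measurable section of a field over a `σ`-finite measure becomes square-integrable after
multiplication by a nowhere vanishing measurable function. -/
theorem exists_smul_mem_squareIntegrable [SigmaFinite σ] {s : ∀ l, K l} (hs : s ∈ F.sections) :
    ∃ c : X → ℂ, AEMeasurable c σ ∧ (∀ l, c l ≠ 0) ∧
      (fun l => c l • s l) ∈ F.squareIntegrable := by
  obtain ⟨g, hpos, hmeas, hint⟩ := exists_pos_lintegral_lt_of_sigmaFinite σ one_ne_zero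
  -- The weight `√g / (1 + ‖s‖)` bounds the norm of the section by `√g`, which is in `L²`.
  let a : X → ℝ := fun l => √(g l)
  let b : X → ℝ := fun l => a l / (1 + ‖s l‖)
  have ha : Measurable a := hmeas.coe_nnreal_real.sqrt
  have hb : AEMeasurable b σ :=
    ha.aemeasurable.div (aemeasurable_const.add (F.aemeasurable_norm s hs))
  have ha0 : ∀ l, 0 < a l := fun l => Real.sqrt_pos.2 (hpos l)
  have hb0 : ∀ l, 0 < b l := fun l => div_pos (ha0 l) (by positivity)
  have ha2 : MemLp a 2 σ := by
    rw [memLp_two_iff_integrable_sq ha.aestronglyMeasurable]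
    have : (fun l => a l ^ 2) = fun l => (g l : ℝ) :=
      funext fun l => Real.sq_sqrt (g l).coe_nonneg
    rw [this]
    refine ⟨hmeas.coe_nnreal_real.aestronglyMeasurable, ?_⟩
    rw [HasFiniteIntegral]
    refine lt_of_eq_of_lt (lintegral_congr fun l => ?_) (hint.trans ENNReal.one_lt_top)
    simp [enorm_eq_nnnorm]
  refine ⟨fun l => (b l : ℂ), Complex.measurable_ofReal.comp_aemeasurable hb,
    fun l => Complex.ofReal_ne_zero.2 (hb0 l).ne', mem_squareIntegrable_of_norm_le
      (smul_mem_sections (Complex.measurable_ofReal.comp_aemeasurable hb) hs) ha2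
      (Filter.Eventually.of_forall fun l => ?_)⟩
  rw [norm_smul, Complex.norm_real, Real.norm_of_nonneg (hb0 l).le]
  calc b l * ‖s l‖ ≤ b l * (1 + ‖s l‖) := by
        have := (hb0 l).le
        gcongr
        linarith
    _ = a l := div_mul_cancel₀ _ (by positivity)

theorem _root_.Submodule.span_smul_range_eq {E : Type*} [AddCommGroup E] [Module ℂ E]
    {ι : Type*} (f : ι → E) {c : ι → ℂ} (hc : ∀ i, c i ≠ 0) :
    Submodule.span ℂ (Set.range fun i => c i • f i) = Submodule.span ℂ (Set.range f) := by
  refine le_antisymm (Submodule.span_le.2 ?_) (Submodule.span_le.2 ?_)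
  · rintro _ ⟨i, rfl⟩
    exact Submodule.smul_mem _ _ (Submodule.subset_span ⟨i, rfl⟩)
  · rintro _ ⟨i, rfl⟩
    have := Submodule.smul_mem (Submodule.span ℂ (Set.range fun i => c i • f i)) (c i)⁻¹
      (Submodule.subset_span ⟨i, rfl⟩)
    simpa [smul_smul, inv_mul_cancel₀ (hc i)] using this

variable (F) in
/-- Over a `σ`-finite measure the total sequence of sections can be taken square-integrable. -/
theorem exists_total_directIntegral [SigmaFinite σ] :
    ∃ e : ℕ → F.DirectIntegral, ∀ᵐ l ∂σ,
      (Submodule.span ℂ (Set.range fun n => (e n).component l)).topologicalClosure = ⊤ := by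
  obtain ⟨e, he, htot⟩ := F.exists_total
  choose c _ hc hmem using fun n => exists_smul_mem_squareIntegrable (he n)
  refine ⟨fun n => toDirect (hmem n), ?_⟩
  filter_upwards [ae_all_iff.2 fun n => component_toDirect (hmem n)] with l hl
  simp only [hl]
  rw [Submodule.span_smul_range_eq _ fun n => hc n l]
  exact htot l

end MeasurableField

/-! ### Decomposable unitary operators -/

namespace SpectralDecomposition

variable {H : Type u} [NormedAddCommGroup H] [InnerProductSpace ℂ H] [CompleteSpace H]
  {G : H →L[ℂ] H} (D : SpectralDecomposition.{u, v} G)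

theorem ext_component {x y : H} (h : ∀ᵐ l ∂D.σ, D.component x l = D.component y l) : x = y :=
  D.W.injective (MeasurableField.ext_component h)

theorem component_mem (x : H) : D.component x ∈ D.field.squareIntegrable :=
  MeasurableField.component_mem _

theorem component_add (x y : H) :
    ∀ᵐ l ∂D.σ, D.component (x + y) l = D.component x l + D.component y l := by
  simpa only [component, map_add] using MeasurableField.component_add (D.W x) (D.W y)

theorem component_smul (c : ℂ) (x : H) :
    ∀ᵐ l ∂D.σ, D.component (c • x) l = c • D.component x l := by
  simpa only [component, map_smul] using MeasurableField.component_smul c (D.W x)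

theorem component_symm_toDirect {s : ∀ l, D.K l} (hs : s ∈ D.field.squareIntegrable) :
    ∀ᵐ l ∂D.σ, D.component (D.W.symm (MeasurableField.toDirect hs)) l = s l := by
  simpa only [component, LinearIsometryEquiv.apply_symm_apply] using
    MeasurableField.component_toDirect hs

theorem inner_eq (x y : H) :
    inner ℂ x y = ∫ l, inner ℂ (D.component x l) (D.component y l) ∂D.σ := by
  rw [← D.W.inner_map_map, MeasurableField.inner_eq]
  rfl

theorem integrable_inner (x y : H) :
    Integrable (fun l => inner ℂ (D.component x l) (D.component y l)) D.σ :=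
  MeasurableField.integrable_inner_component _ _

theorem component_pow (n : ℕ) (x : H) :
    ∀ᵐ l ∂D.σ, D.component ((G ^ n) x) l = ((l : ℝ) : ℂ) ^ n • D.component x l := by
  induction n with
  | zero => simp
  | succ n ih =>
    filter_upwards [ih, D.mul_apply ((G ^ n) x)] with l h1 h2
    rw [pow_succ', mul_apply_eq_comp, pow_succ', mul_smul, ← h1]
    exact h2

theorem inner_pow (n : ℕ) (x y : H) :
    inner ℂ x ((G ^ n) y) =
      ∫ l, ((l : ℝ) : ℂ) ^ n * inner ℂ (D.component x l) (D.component y l) ∂D.σ := by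
  rw [D.inner_eq]
  refine integral_congr_ae ?_
  filter_upwards [D.component_pow n y] with l hl
  rw [hl, inner_smul_right]

/-- The fibrewise inner products of two vectors are determined by the moments of `G`. -/
theorem ae_inner_eq_of_inner_pow_eq {x y x' y' : H}
    (h : ∀ n : ℕ, inner ℂ x ((G ^ n) y) = inner ℂ x' ((G ^ n) y')) :
    ∀ᵐ l ∂D.σ, inner ℂ (D.component x l) (D.component y l) =
      inner ℂ (D.component x' l) (D.component y' l) :=
  ae_eq_of_moments_eq (D.integrable_inner x y) (D.integrable_inner x' y') fun n => by
    rw [← D.inner_pow, ← D.inner_pow, h]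

theorem exists_total : ∃ e : ℕ → H, ∀ᵐ l ∂D.σ,
    (Submodule.span ℂ (Set.range fun n => D.component (e n) l)).topologicalClosure = ⊤ := by
  obtain ⟨e, he⟩ := D.field.exists_total_directIntegral
  exact ⟨fun n => D.W.symm (e n), by
    simpa only [component, LinearIsometryEquiv.apply_symm_apply] using he⟩

variable {D}

theorem IsDecomposed.unique {V : ∀ l, D.K l ≃ₗᵢ[ℂ] D.K l} {U U' : H →L[ℂ] H}
    (h : D.IsDecomposed V U) (h' : D.IsDecomposed V U') : U = U' :=
  ContinuousLinearMap.ext fun x => D.ext_component <| by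
    filter_upwards [h x, h' x] with l h1 h2
    rw [h1, h2]

theorem exists_isDecomposed {V : ∀ l, D.K l ≃ₗᵢ[ℂ] D.K l}
    (hV : D.field.IsMeasurableUnitaryField V) : ∃ U : H →L[ℂ] H, D.IsDecomposed V U := by
  have hmem : ∀ x, (fun l => V l (D.component x l)) ∈ D.field.squareIntegrable := fun x =>
    ⟨hV _ (D.component_mem x).1, by simpa using (D.component_mem x).2⟩
  let U : H → H := fun x => D.W.symm (MeasurableField.toDirect (hmem x))
  have hU : ∀ x, ∀ᵐ l ∂D.σ, D.component (U x) l = V l (D.component x l) := fun x =>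
    D.component_symm_toDirect (hmem x)
  have hadd : ∀ x y, U (x + y) = U x + U y := fun x y => D.ext_component <| by
    filter_upwards [hU (x + y), hU x, hU y, D.component_add x y, D.component_add (U x) (U y)]
      with l h1 h2 h3 h4 h5
    rw [h1, h4, h5, h2, h3, map_add]
  have hsmul : ∀ (c : ℂ) x, U (c • x) = c • U x := fun c x => D.ext_component <| by
    filter_upwards [hU (c • x), hU x, D.component_smul c x, D.component_smul c (U x)]
      with l h1 h2 h3 h4
    rw [h1, h3, h4, h2, map_smul]
  have hnorm : ∀ x, ‖U x‖ = ‖x‖ := fun x => by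
    rw [@norm_eq_sqrt_re_inner ℂ, @norm_eq_sqrt_re_inner ℂ _ _ _ _ x, D.inner_eq, D.inner_eq]
    congr 2
    refine integral_congr_ae ?_
    filter_upwards [hU x] with l hl
    rw [hl, LinearIsometryEquiv.inner_map_map]
  let L : H →ₗ[ℂ] H := { toFun := U, map_add' := hadd, map_smul' := hsmul }
  exact ⟨L.mkContinuous 1 fun x => by simpa [L] using (hnorm x).le, hU⟩

/-- The adjoint of a measurable field of unitary operators is measurable, by maximality of the
space of measurable sections. -/
theorem _root_.MeasurableField.IsMeasurableUnitaryField.symm {V : ∀ l, D.K l ≃ₗᵢ[ℂ] D.K l}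
    (hV : D.field.IsMeasurableUnitaryField V) :
    D.field.IsMeasurableUnitaryField fun l => (V l).symm := fun s hs =>
  D.field.mem_of_aemeasurable_inner _ fun r hr =>
    (D.field.aemeasurable_inner (hV r hr) hs).congr <| Filter.Eventually.of_forall fun l => by
      simp only [← (V l).inner_map_map (r l), LinearIsometryEquiv.apply_symm_apply]

theorem IsDecomposed.comp {V V' : ∀ l, D.K l ≃ₗᵢ[ℂ] D.K l} {U U' : H →L[ℂ] H}
    (h : D.IsDecomposed V U) (h' : D.IsDecomposed V' U') (hinv : ∀ l x, V l (V' l x) = x)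
    (x : H) : U (U' x) = x :=
  D.ext_component <| by
    filter_upwards [h (U' x), h' x] with l h1 h2
    rw [h1, h2, hinv]

theorem IsDecomposed.inner_map_map {V : ∀ l, D.K l ≃ₗᵢ[ℂ] D.K l} {U : H →L[ℂ] H}
    (h : D.IsDecomposed V U) (x y : H) : inner ℂ (U x) (U y) = inner ℂ x y := by
  rw [D.inner_eq, D.inner_eq]
  refine integral_congr_ae ?_
  filter_upwards [h x, h y] with l h1 h2
  rw [h1, h2, LinearIsometryEquiv.inner_map_map]

theorem IsDecomposed.map_apply {V : ∀ l, D.K l ≃ₗᵢ[ℂ] D.K l} {U : H →L[ℂ] H}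
    (h : D.IsDecomposed V U) (x : H) : G (U x) = U (G x) :=
  D.ext_component <| by
    filter_upwards [D.mul_apply (U x), D.mul_apply x, h x, h (G x)] with l h1 h2 h3 h4
    rw [h4, component, h1, component, h2, map_smul]
    exact congrArg _ h3

theorem IsDecomposed.isBiUnitary {h₂ : HermitianStructure H}
    (hG : ∀ x y, h₂.form x y = inner ℂ (G x) y) {V : ∀ l, D.K l ≃ₗᵢ[ℂ] D.K l}
    (hV : D.field.IsMeasurableUnitaryField V) {U : H →L[ℂ] H} (h : D.IsDecomposed V U) :
    IsBiUnitary h₂ U := by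
  obtain ⟨U', hU'⟩ := exists_isDecomposed hV.symm
  refine ⟨⟨Function.LeftInverse.injective (g := U') fun x => ?_, fun x => ⟨U' x, ?_⟩⟩,
    h.inner_map_map, fun x y => ?_⟩
  · exact hU'.comp h (fun l => (V l).symm_apply_apply) x
  · exact h.comp hU' (fun l => (V l).apply_symm_apply) x
  · rw [hG, hG, h.map_apply, h.inner_map_map]

end SpectralDecomposition

section BiUnitary

variable {H : Type u} [NormedAddCommGroup H] [InnerProductSpace ℂ H] {G : H →L[ℂ] H}

theorem IsBiUnitary.map_apply {h₂ : HermitianStructure H}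
    (hG : ∀ x y, h₂.form x y = inner ℂ (G x) y) {U : H →L[ℂ] H} (hU : IsBiUnitary h₂ U) (x : H) :
    G (U x) = U (G x) := by
  refine ext_inner_right ℂ fun z => ?_
  obtain ⟨y, rfl⟩ := hU.1.2 z
  rw [← hG, hU.2.2, hU.2.1, hG]

theorem IsBiUnitary.pow_map_apply {h₂ : HermitianStructure H}
    (hG : ∀ x y, h₂.form x y = inner ℂ (G x) y) {U : H →L[ℂ] H} (hU : IsBiUnitary h₂ U) (n : ℕ)
    (x : H) : (G ^ n) (U x) = U ((G ^ n) x) := by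
  induction n with
  | zero => simp
  | succ n ih =>
    rw [pow_succ', mul_apply_eq_comp, mul_apply_eq_comp, ih,
      hU.map_apply hG]

/-- A bi-unitary operator commutes with `G`, so it preserves the moments `⟪x, G ^ n y⟫` and hence
almost all fibrewise inner products. On a sequence `f` such that both `f` and its image under `U`
are total in almost every fibre, this yields the unitary operators on the fibres. -/
theorem IsBiUnitary.exists_isDecomposed [CompleteSpace H] {h₂ : HermitianStructure H}
    (hG : ∀ x y, h₂.form x y = inner ℂ (G x) y) {U : H →L[ℂ] H} (hU : IsBiUnitary h₂ U)
    (D : SpectralDecomposition.{u, v} G) :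
    ∃ V : ∀ l, D.K l ≃ₗᵢ[ℂ] D.K l, D.field.IsMeasurableUnitaryField V ∧ D.IsDecomposed V U := by
  obtain ⟨e, he⟩ := D.exists_total
  choose e' he' using fun n => hU.1.2 (e n)
  let f : ℕ ⊕ ℕ → H := Sum.elim e e'
  have hgram : ∀ x y : H, ∀ᵐ l ∂D.σ, inner ℂ (D.component x l) (D.component y l) =
      inner ℂ (D.component (U x) l) (D.component (U y) l) := fun x y =>
    D.ae_inner_eq_of_inner_pow_eq fun n => by rw [hU.pow_map_apply hG, hU.2.1]
  have htot : ∀ᵐ l ∂D.σ, (Submodule.span ℂ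
      (Set.range fun i => D.component (f i) l)).topologicalClosure = ⊤ := by
    filter_upwards [he] with l hl
    refine top_le_iff.1 (hl.ge.trans (Submodule.topologicalClosure_mono (Submodule.span_mono ?_)))
    rintro _ ⟨n, rfl⟩
    exact ⟨Sum.inl n, rfl⟩
  have htot' : ∀ᵐ l ∂D.σ, (Submodule.span ℂ
      (Set.range fun i => D.component (U (f i)) l)).topologicalClosure = ⊤ := by
    filter_upwards [he] with l hl
    refine top_le_iff.1 (hl.ge.trans (Submodule.topologicalClosure_mono (Submodule.span_mono ?_)))
    rintro _ ⟨n, rfl⟩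
    exact ⟨Sum.inr n, by simp only [f, Sum.elim_inr, he']⟩
  -- On the null set where the Gram matrix lemma does not apply, the identity is used.
  have hV : ∀ l, ∃ V : D.K l ≃ₗᵢ[ℂ] D.K l,
      ((∀ i j, inner ℂ (D.component (f i) l) (D.component (f j) l) =
        inner ℂ (D.component (U (f i)) l) (D.component (U (f j)) l)) ∧
      (Submodule.span ℂ (Set.range fun i => D.component (f i) l)).topologicalClosure = ⊤ ∧
      (Submodule.span ℂ (Set.range fun i => D.component (U (f i)) l)).topologicalClosure = ⊤) →
      ∀ i, V (D.component (f i) l) = D.component (U (f i)) l := fun l => by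
    by_cases h : (∀ i j, inner ℂ (D.component (f i) l) (D.component (f j) l) =
        inner ℂ (D.component (U (f i)) l) (D.component (U (f j)) l)) ∧
      (Submodule.span ℂ (Set.range fun i => D.component (f i) l)).topologicalClosure = ⊤ ∧
      (Submodule.span ℂ (Set.range fun i => D.component (U (f i)) l)).topologicalClosure = ⊤
    · obtain ⟨V, hV⟩ := exists_linearIsometryEquiv_of_inner_eq h.2.1 h.2.2 h.1
      exact ⟨V, fun _ => hV⟩
    · exact ⟨LinearIsometryEquiv.refl ℂ _, fun h' => absurd h' h⟩
  choose V hV using hV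
  have hVf : ∀ᵐ l ∂D.σ, ∀ i, V l (D.component (f i) l) = D.component (U (f i)) l := by
    filter_upwards [ae_all_iff.2 fun i => ae_all_iff.2 fun j => hgram (f i) (f j), htot, htot']
      with l h1 h2 h3
    exact hV l ⟨h1, h2, h3⟩
  have hdec : D.IsDecomposed V U := fun x => by
    filter_upwards [hVf, htot', ae_all_iff.2 fun i => hgram (f i) x] with l h1 h2 h3
    refine sub_eq_zero.1 (eq_zero_of_forall_inner_eq_zero h2 fun i => ?_)
    rw [inner_sub_right, ← h3, ← h1, LinearIsometryEquiv.inner_map_map, sub_self]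
  -- A measurable section is a function times the components of a vector `x`, and its image under
  -- `V` is the same function times the components of `U x`.
  refine ⟨V, fun s hs => ?_, hdec⟩
  obtain ⟨c, hc, hc0, hmem⟩ := MeasurableField.exists_smul_mem_squareIntegrable hs
  refine MeasurableField.mem_sections_congr_ae (MeasurableField.smul_mem_sections hc.inv
    (D.component_mem (U (D.W.symm (MeasurableField.toDirect hmem)))).1) ?_
  filter_upwards [hdec (D.W.symm (MeasurableField.toDirect hmem)),
    D.component_symm_toDirect hmem] with l h1 h2
  rw [h1, h2, map_smul, smul_smul, Pi.inv_apply, inv_mul_cancel₀ (hc0 l), one_smul]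

end BiUnitary

/-! ### Phase multiplications and the Borel functional calculus -/

/-- Multiplication by `e^{iθ}` as a unitary operator. -/
def phaseEquiv (E : Type*) [NormedAddCommGroup E] [InnerProductSpace ℂ E] (θ : ℝ) :
    E ≃ₗᵢ[ℂ] E where
  toLinearEquiv := LinearEquiv.smulOfNeZero ℂ E (Complex.exp (Complex.I * θ))
    (Complex.exp_ne_zero _)
  norm_map' x := by
    simp [norm_smul, mul_comm Complex.I, Complex.norm_exp_ofReal_mul_I]

theorem IsSpectralMeasureAt.unique {H : Type u} [NormedAddCommGroup H] [InnerProductSpace ℂ H]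
    [CompleteSpace H] {G : H →L[ℂ] H} {x : H} {μ ν : Measure (spectrum ℝ G)}
    (hμ : IsSpectralMeasureAt G x μ) (hν : IsSpectralMeasureAt G x ν) : μ = ν := by
  have := hμ.1
  have := hν.1
  exact measure_eq_of_moments_eq fun n => by rw [hμ.2, hν.2]

namespace SpectralDecomposition

variable {H : Type u} [NormedAddCommGroup H] [InnerProductSpace ℂ H] [CompleteSpace H]
  {G : H →L[ℂ] H} (D : SpectralDecomposition.{u, v} G)

/-- The spectral measure of `G` in the vector `x`, read off from the decomposition as
`‖x l‖² dσ(l)`. -/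
def spectralMeasure (x : H) : Measure (spectrum ℝ G) :=
  D.σ.withDensity fun l => ENNReal.ofReal (‖D.component x l‖ ^ 2)

theorem integral_spectralMeasure (x : H) (f : spectrum ℝ G → ℂ) :
    ∫ l, f l ∂D.spectralMeasure x =
      ∫ l, f l * inner ℂ (D.component x l) (D.component x l) ∂D.σ := by
  rw [spectralMeasure, integral_withDensity_eq_integral_toReal_smul₀
    ((D.field.aemeasurable_norm _ (D.component_mem x).1).pow_const 2).ennreal_ofReal
    (Filter.Eventually.of_forall fun _ => ENNReal.ofReal_lt_top)]
  refine integral_congr_ae (Filter.Eventually.of_forall fun l => ?_)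
  simp [inner_self_eq_norm_sq_to_K, mul_comm]

theorem isSpectralMeasureAt_spectralMeasure (x : H) :
    IsSpectralMeasureAt G x (D.spectralMeasure x) := by
  refine ⟨?_, fun n => ?_⟩
  · refine isFiniteMeasure_withDensity_ofReal ?_
    exact ((memLp_two_iff_integrable_sq (D.component_mem x).2.1).1 (D.component_mem x).2).2
  · rw [D.integral_spectralMeasure, D.inner_pow]

variable {D}

theorem isMeasurableUnitaryField_phaseEquiv {θ : spectrum ℝ G → ℝ} (hθ : AEMeasurable θ D.σ) :
    D.field.IsMeasurableUnitaryField fun l => phaseEquiv (D.K l) (θ l) := fun _ hs =>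
  MeasurableField.smul_mem_sections
    ((Complex.measurable_ofReal.comp_aemeasurable hθ).const_mul Complex.I).cexp hs

theorem isPhaseMultiplication_iff {θ : spectrum ℝ G → ℝ} {U : H →L[ℂ] H} :
    D.IsPhaseMultiplication θ U ↔ D.IsDecomposed (fun l => phaseEquiv (D.K l) (θ l)) U :=
  Iff.rfl

theorem exists_isPhaseMultiplication {θ : spectrum ℝ G → ℝ} (hθ : AEMeasurable θ D.σ) :
    ∃ U : H →L[ℂ] H, D.IsPhaseMultiplication θ U :=
  exists_isDecomposed (isMeasurableUnitaryField_phaseEquiv hθ)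

theorem IsPhaseMultiplication.inner_apply {θ : spectrum ℝ G → ℝ} {U : H →L[ℂ] H}
    (hU : D.IsPhaseMultiplication θ U) (x : H) :
    inner ℂ x (U x) = ∫ l, Complex.exp (Complex.I * θ l) ∂D.spectralMeasure x := by
  rw [D.integral_spectralMeasure, D.inner_eq]
  refine integral_congr_ae ?_
  filter_upwards [hU x] with l hl
  rw [hl, inner_smul_right]

theorem IsPhaseMultiplication.isFunctionOf {θ : spectrum ℝ G → ℝ} (hθ : AEMeasurable θ D.σ)
    {U : H →L[ℂ] H} (hU : D.IsPhaseMultiplication θ U) :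
    IsFunctionOf G (fun l => Complex.exp (Complex.I * θ l)) U := fun x => by
  have hμ := D.isSpectralMeasureAt_spectralMeasure x
  refine ⟨_, hμ, ?_, hU.inner_apply x⟩
  have := hμ.1
  have hθ' : AEMeasurable θ (D.spectralMeasure x) :=
    hθ.mono_ac (withDensity_absolutelyContinuous _ _)
  refine Integrable.of_bound
    ((Complex.measurable_ofReal.comp_aemeasurable hθ').const_mul
      Complex.I).cexp.aestronglyMeasurable 1 (Filter.Eventually.of_forall fun l => ?_)
  rw [mul_comm]
  exact (Complex.norm_exp_ofReal_mul_I _).le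

theorem isPhaseMultiplication_of_isFunctionOf {θ : spectrum ℝ G → ℝ} (hθ : AEMeasurable θ D.σ)
    {U : H →L[ℂ] H} (hU : IsFunctionOf G (fun l => Complex.exp (Complex.I * θ l)) U) :
    D.IsPhaseMultiplication θ U := by
  -- By uniqueness of spectral measures, `U` has the same quadratic form as multiplication by
  -- `e^{iθ}`.
  obtain ⟨U', hU'⟩ := exists_isPhaseMultiplication hθ
  have h : U' = U := by
    refine ContinuousLinearMap.coe_injective ((ext_inner_map _ _).1 fun x => ?_)
    obtain ⟨μ, hμ, -, hx⟩ := hU x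
    rw [hμ.unique (D.isSpectralMeasureAt_spectralMeasure x), ← hU'.inner_apply] at hx
    have := congrArg (starRingEnd ℂ) hx
    rwa [inner_conj_symm, inner_conj_symm, eq_comm] at this
  exact h ▸ hU'

/-! ### Cyclic operators -/

variable (D) in
/-- If `ψ` is cyclic, the components of every vector are multiples of the components of `ψ`:
the part of a section that is fibrewise orthogonal to `ψ` is orthogonal to all `G ^ n ψ`.
Where `ψ l = 0` the quotient is `0`, so the statement includes that `x l = 0` there. -/
theorem component_eq_smul_of_cyclic {ψ : H}
    (hψ : (Submodule.span ℂ (Set.range fun n : ℕ => (G ^ n) ψ)).topologicalClosure = ⊤) (x : H) :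
    ∀ᵐ l ∂D.σ, D.component x l = (inner ℂ (D.component ψ l) (D.component x l) /
      inner ℂ (D.component ψ l) (D.component ψ l)) • D.component ψ l := by
  let a : spectrum ℝ G → ℂ := fun l => inner ℂ (D.component ψ l) (D.component x l) /
      inner ℂ (D.component ψ l) (D.component ψ l)
  have ha : AEMeasurable a D.σ :=
    (D.field.aemeasurable_inner (D.component_mem ψ).1 (D.component_mem x).1).div
      (D.field.aemeasurable_inner (D.component_mem ψ).1 (D.component_mem ψ).1)
  have ht : (D.component x - fun l => a l • D.component ψ l) ∈ D.field.sections :=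
    D.field.sections.sub_mem (D.component_mem x).1
      (MeasurableField.smul_mem_sections ha (D.component_mem ψ).1)
  have horth : ∀ l, inner ℂ (D.component ψ l)
      ((D.component x - fun l => a l • D.component ψ l) l) = 0 := fun l => by
    rw [Pi.sub_apply, inner_sub_right, inner_smul_right]
    rcases eq_or_ne (D.component ψ l) 0 with h0 | h0
    · simp [h0]
    · rw [div_mul_cancel₀ _ (inner_self_ne_zero.2 h0), sub_self]
  -- Up to a nowhere vanishing factor, the orthogonal part is the section of a vector of `H`.
  obtain ⟨c, -, hc0, hmem⟩ := MeasurableField.exists_smul_mem_squareIntegrable ht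
  have hcomp := D.component_symm_toDirect hmem
  have hzero : D.W.symm (MeasurableField.toDirect hmem) = 0 := by
    refine eq_zero_of_forall_inner_eq_zero hψ fun n => ?_
    rw [D.inner_eq, ← integral_zero (spectrum ℝ G) ℂ (μ := D.σ)]
    refine integral_congr_ae ?_
    filter_upwards [hcomp, D.component_pow n ψ] with l h1 h2
    rw [h1, h2, inner_smul_left, inner_smul_right, horth, mul_zero, mul_zero]
  -- The components of `0` are those of a chosen representative, zero only almost everywhere.
  have h0 := D.component_smul 0 (0 : H)
  filter_upwards [hcomp, h0] with l h1 h2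
  rw [zero_smul, zero_smul] at h2
  rw [hzero, h2] at h1
  exact sub_eq_zero.1 ((smul_eq_zero.1 h1.symm).resolve_left (hc0 l))

variable (D) in
theorem finrank_eq_one_of_cyclic (hG : IsCyclicOperator G) :
    ∀ᵐ l ∂D.σ, Module.finrank ℂ (D.K l) = 1 := by
  obtain ⟨ψ, hψ⟩ := hG
  obtain ⟨e, he⟩ := D.exists_total
  filter_upwards [he, D.nontrivial, ae_all_iff.2 fun n => D.component_eq_smul_of_cyclic hψ (e n)]
    with l h1 h2 h3
  have htop : ∀ x : D.K l, x ∈ Submodule.span ℂ {D.component ψ l} := fun x => by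
    refine Submodule.topologicalClosure_minimal (t := Submodule.span ℂ {D.component ψ l}) _ ?_
      (Submodule.closed_of_finiteDimensional _) (h1 ▸ Submodule.mem_top)
    rw [Submodule.span_le]
    rintro _ ⟨n, rfl⟩
    exact Submodule.mem_span_singleton.2 ⟨_, (h3 n).symm⟩
  refine finrank_eq_one (D.component ψ l) (fun h0 => ?_) fun x =>
    Submodule.mem_span_singleton.1 (htop x)
  obtain ⟨x, hx⟩ := exists_ne (0 : D.K l)
  have := htop x
  rw [h0, Submodule.span_zero_singleton] at this
  exact hx this

/-- A unitary operator on a one-dimensional fibre is a scalar of modulus one, whose argument is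
that of `⟪ψ l, V(l) ψ l⟫`. -/
theorem IsDecomposed.exists_isPhaseMultiplication (hG : IsCyclicOperator G)
    {V : ∀ l, D.K l ≃ₗᵢ[ℂ] D.K l} {U : H →L[ℂ] H} (hU : D.IsDecomposed V U) :
    ∃ θ : spectrum ℝ G → ℝ, AEMeasurable θ D.σ ∧ D.IsPhaseMultiplication θ U := by
  obtain ⟨ψ, hψ⟩ := hG
  let z : spectrum ℝ G → ℂ := fun l => inner ℂ (D.component ψ l) (D.component (U ψ) l)
  have hz : AEMeasurable z D.σ :=
    D.field.aemeasurable_inner (D.component_mem ψ).1 (D.component_mem (U ψ)).1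
  refine ⟨fun l => (z l).arg, Complex.measurable_arg.comp_aemeasurable hz, fun x => ?_⟩
  filter_upwards [hU ψ, hU x, D.component_eq_smul_of_cyclic hψ x,
    D.component_eq_smul_of_cyclic hψ (U ψ)] with l h1 h2 h3 h4
  rw [h2, h3, map_smul, ← h1, smul_comm]
  congr 1
  rcases eq_or_ne (D.component ψ l) 0 with h0 | h0
  · rw [h1, h0, map_zero, smul_zero]
  · have hn : ‖D.component ψ l‖ ≠ 0 := norm_ne_zero_iff.2 h0
    have hii : inner ℂ (D.component ψ l) (D.component ψ l) =
        ((‖D.component ψ l‖ ^ 2 : ℝ) : ℂ) := by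
      simp [inner_self_eq_norm_sq_to_K]
    have hzn : ‖z l‖ = ‖D.component ψ l‖ ^ 2 := by
      have := congrArg norm h4
      rw [norm_smul, norm_div, hii, Complex.norm_real, Real.norm_of_nonneg (by positivity), h1,
        LinearIsometryEquiv.norm_map, ← h1] at this
      change _ = ‖z l‖ / _ * _ at this
      field_simp at this
      nlinarith [this]
    rw [h4, hii, ← hzn]
    change (z l / _) • _ = _
    congr 1
    rw [div_eq_iff (by rw [hzn]; exact_mod_cast pow_ne_zero 2 hn), mul_comm, mul_comm Complex.I,
      Complex.norm_mul_exp_arg_mul_I]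

end SpectralDecomposition

/-! ### Positivity of the relating operator -/

theorem isPositive_of_form_eq {H : Type u} [NormedAddCommGroup H] [InnerProductSpace ℂ H]
    {h₂ : HermitianStructure H} {G : H →L[ℂ] H}
    (hG : ∀ x y, h₂.form x y = inner ℂ (G x) y) : G.IsPositive := by
  rw [ContinuousLinearMap.isPositive_iff_complex]
  intro x
  rw [← hG]
  refine ⟨Complex.conj_eq_iff_re.1 (h₂.conj_symm x x), ?_⟩
  rcases eq_or_ne x 0 with rfl | hx
  · simp
  · exact (h₂.pos x hx).le

/-! ### Existence of spectral measures -/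

section SpectralMeasure

variable {H : Type u} [NormedAddCommGroup H] [InnerProductSpace ℂ H] [CompleteSpace H]
  {G : H →L[ℂ] H}

theorem IsSelfAdjoint.inner_pow_left (hG : IsSelfAdjoint G) (n : ℕ) (x y : H) :
    inner ℂ ((G ^ n) x) y = inner ℂ x ((G ^ n) y) := by
  have h := ContinuousLinearMap.adjoint_inner_right (G ^ n) x y
  rw [← ContinuousLinearMap.star_eq_adjoint, (hG.pow n).star_eq] at h
  exact h.symm

/-- The positive functional `f ↦ ⟪x, f(G) x⟫` on the continuous functions on the spectrum. -/
def spectralFunctional (hG : IsSelfAdjoint G) (x : H) :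
    CompactlySupportedContinuousMap (spectrum ℝ G) ℝ →ₚ[ℝ] ℝ :=
  PositiveLinearMap.mk₀
    { toFun := fun f => (inner ℂ x (cfcHom hG f.toContinuousMap x)).re
      map_add' := fun f g => by
        change (inner ℂ x (cfcHom hG (f.toContinuousMap + g.toContinuousMap) x)).re = _
        rw [map_add, add_apply, inner_add_right, Complex.add_re]
      map_smul' := fun c f => by
        change (inner ℂ x (cfcHom hG (c • f.toContinuousMap) x)).re = _
        rw [map_smul, smul_apply, ← Complex.coe_smul, inner_smul_right]
        simp }
    fun f hf => by
      -- A nonnegative `f` is the square of its square root.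
      let g : C(spectrum ℝ G, ℝ) := ⟨fun l => √(f l), by fun_prop⟩
      have hfg : f.toContinuousMap = star g * g := by
        ext l
        simpa [g] using (Real.mul_self_sqrt (hf l)).symm
      change 0 ≤ (inner ℂ x (cfcHom hG f.toContinuousMap x)).re
      rw [hfg, map_mul, map_star, mul_apply_eq_comp, ContinuousLinearMap.star_eq_adjoint,
        ContinuousLinearMap.adjoint_inner_right]
      exact inner_self_nonneg (𝕜 := ℂ)

theorem exists_isSpectralMeasureAt (hG : IsSelfAdjoint G) (x : H) :
    ∃ μ, IsSpectralMeasureAt G x μ := by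
  refine ⟨RealRMK.rieszMeasure (spectralFunctional hG x), inferInstance, fun n => ?_⟩
  let p : C(spectrum ℝ G, ℝ) := (ContinuousMap.restrict _ (ContinuousMap.id ℝ)) ^ n
  have h := RealRMK.integral_rieszMeasure (spectralFunctional hG x)
    (CompactlySupportedContinuousMap.continuousMapEquiv p)
  have h1 : spectralFunctional hG x (CompactlySupportedContinuousMap.continuousMapEquiv p) =
      (inner ℂ x ((G ^ n) x)).re := by
    change (inner ℂ x (cfcHom hG p x)).re = _
    rw [map_pow, cfcHom_id]
  rw [h1] at h
  have h2 : ((inner ℂ x ((G ^ n) x)).re : ℂ) = inner ℂ x ((G ^ n) x) :=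
    Complex.conj_eq_iff_re.1 (by rw [inner_conj_symm, hG.inner_pow_left])
  rw [← h2, ← h, ← integral_complex_ofReal]
  refine integral_congr_ae (Filter.Eventually.of_forall fun l => ?_)
  simp [p]

end SpectralMeasure

/-! ### Orthogonal cyclic subspaces -/

section CyclicSpan

variable {H : Type u} [NormedAddCommGroup H] [InnerProductSpace ℂ H] {G : H →L[ℂ] H}

/-- The smallest closed `G`-invariant subspace containing `S`. -/
def cyclicSpan (G : H →L[ℂ] H) (S : Set H) : Submodule ℂ H :=
  (Submodule.span ℂ {y | ∃ x ∈ S, ∃ n : ℕ, (G ^ n) x = y}).topologicalClosure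

theorem subset_cyclicSpan (S : Set H) : S ⊆ cyclicSpan G S := fun x hx =>
  Submodule.le_topologicalClosure _ (Submodule.subset_span ⟨x, hx, 0, rfl⟩)

theorem cyclicSpan_mono {S T : Set H} (h : S ⊆ T) : cyclicSpan G S ≤ cyclicSpan G T :=
  Submodule.topologicalClosure_mono (Submodule.span_mono fun _ ⟨x, hx, n, hn⟩ => ⟨x, h hx, n, hn⟩)

theorem map_mem_cyclicSpan {S : Set H} {x : H} (hx : x ∈ cyclicSpan G S) :
    G x ∈ cyclicSpan G S := by
  have hle : cyclicSpan G S ≤ (cyclicSpan G S).comap G.toLinearMap := by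
    refine Submodule.topologicalClosure_minimal _ (Submodule.span_le.2 ?_)
      ((Submodule.isClosed_topologicalClosure _).preimage G.continuous)
    rintro _ ⟨y, hy, n, rfl⟩
    refine Submodule.le_topologicalClosure _ (Submodule.subset_span ⟨y, hy, n + 1, ?_⟩)
    rw [pow_succ', mul_apply_eq_comp]
    rfl
  exact hle hx

theorem pow_map_mem_cyclicSpan {S : Set H} (n : ℕ) {x : H} (hx : x ∈ cyclicSpan G S) :
    (G ^ n) x ∈ cyclicSpan G S := by
  induction n with
  | zero => exact hx
  | succ n ih =>
    rw [pow_succ', mul_apply_eq_comp]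
    exact map_mem_cyclicSpan ih

theorem cyclicSpan_le_iff {S T : Set H} : cyclicSpan G S ≤ cyclicSpan G T ↔
    S ⊆ cyclicSpan G T := by
  refine ⟨fun h => (subset_cyclicSpan S).trans h, fun h =>
    Submodule.topologicalClosure_minimal _ (Submodule.span_le.2 ?_)
      (Submodule.isClosed_topologicalClosure _)⟩
  rintro _ ⟨x, hx, n, rfl⟩
  exact pow_map_mem_cyclicSpan n (h hx)

/-- A separable space is the closed sum of countably many orthogonal cyclic subspaces of a
self-adjoint operator, by the Gram–Schmidt procedure: each member of a dense sequence is projected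
off the closed invariant subspace generated by its predecessors. -/
theorem exists_orthogonal_cyclic [CompleteSpace H] [TopologicalSpace.SeparableSpace H]
    (hG : IsSelfAdjoint G) : ∃ x : ℕ → H,
      (∀ m n, m ≠ n → ∀ k : ℕ, inner ℂ (x m) ((G ^ k) (x n)) = 0) ∧
      (Submodule.span ℂ (Set.range fun p : ℕ × ℕ => (G ^ p.2) (x p.1))).topologicalClosure = ⊤ := by
  let d := TopologicalSpace.denseSeq H
  let M : ℕ → Submodule ℂ H := fun n => cyclicSpan G (d '' Set.Iio n)
  have : ∀ n, CompleteSpace (M n) := fun n =>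
    (Submodule.isClosed_topologicalClosure _).completeSpace_coe
  let x : ℕ → H := fun n => d n - (M n).starProjection (d n)
  have hmono : Monotone M := fun m n h =>
    cyclicSpan_mono (Set.image_mono (Set.Iio_subset_Iio h))
  have horth : ∀ n, x n ∈ (M n)ᗮ := fun n => (M n).sub_starProjection_mem_orthogonal (d n)
  have hproj : ∀ n, (M n).starProjection (d n) ∈ M n := fun n =>
    Submodule.starProjection_apply_mem _ _
  have hd : ∀ n, d n ∈ M (n + 1) := fun n => subset_cyclicSpan _ ⟨n, n.lt_succ_self, rfl⟩
  have hx : ∀ n, x n ∈ M (n + 1) := fun n =>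
    (M (n + 1)).sub_mem (hd n) (hmono n.le_succ (hproj n))
  have hlt : ∀ m n, m < n → ∀ k : ℕ, inner ℂ (x m) ((G ^ k) (x n)) = 0 := fun m n h k => by
    rw [← hG.inner_pow_left]
    exact Submodule.inner_right_of_mem_orthogonal
      (pow_map_mem_cyclicSpan k (hmono (Nat.succ_le_of_lt h) (hx m))) (horth n)
  refine ⟨x, fun m n hne k => ?_, ?_⟩
  · rcases lt_or_gt_of_ne hne with h | h
    · exact hlt m n h k
    · rw [← inner_conj_symm, hG.inner_pow_left, hlt n m h k, map_zero]
  · have hle : ∀ n, M n ≤ cyclicSpan G (Set.range x) := by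
      intro n
      induction n with
      | zero => exact cyclicSpan_le_iff.2 (by simp)
      | succ n ih =>
        refine cyclicSpan_le_iff.2 ?_
        rintro _ ⟨j, hj, rfl⟩
        rcases (Nat.lt_succ_iff_lt_or_eq.1 hj) with h | rfl
        · exact ih (subset_cyclicSpan _ ⟨j, h, rfl⟩)
        · have := Submodule.add_mem _ (subset_cyclicSpan (G := G) _ (Set.mem_range_self (f := x) j))
            (ih (hproj j))
          simpa [x] using this
    have hset : {y | ∃ z ∈ Set.range x, ∃ n : ℕ, (G ^ n) z = y} =
        Set.range fun p : ℕ × ℕ => (G ^ p.2) (x p.1) := by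
      ext y
      simp
    rw [← hset, ← Submodule.dense_iff_topologicalClosure_eq_top]
    refine dense_closure.1 ((TopologicalSpace.denseRange_denseSeq H).mono ?_)
    rintro _ ⟨n, rfl⟩
    exact hle (n + 1) (hd n)

end CyclicSpan

/-! ### Fields of sequence spaces -/

section SequenceField

variable {X : Type w}

/-- The fibre over `l` of the field of sequence spaces given by `S`: the square-summable sequences
supported on `S l`. -/
abbrev SequenceFibre (S : X → Set ℕ) (l : X) : Type := lp (fun _ : S l => ℂ) 2

open Classical in
/-- The `n`-th unit vector where `n ∈ S l`, and `0` elsewhere. -/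
def unitSection (S : X → Set ℕ) (n : ℕ) (l : X) : SequenceFibre S l :=
  if h : n ∈ S l then lp.single 2 ⟨n, h⟩ 1 else 0

theorem unitSection_of_notMem {S : X → Set ℕ} {n : ℕ} {l : X} (h : n ∉ S l) :
    unitSection S n l = 0 := dif_neg h

theorem inner_unitSection {S : X → Set ℕ} {n : ℕ} {l : X} (h : n ∈ S l)
    (t : SequenceFibre S l) : inner ℂ (unitSection S n l) t = t ⟨n, h⟩ := by
  rw [unitSection, dif_pos h, lp.inner_single_left]
  simp

theorem inner_unitSection_self {S : X → Set ℕ} {n : ℕ} {l : X} (h : n ∈ S l) :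
    inner ℂ (unitSection S n l) (unitSection S n l) = 1 := by
  rw [inner_unitSection h, unitSection, dif_pos h]
  simp

theorem inner_unitSection_of_ne {S : X → Set ℕ} {m n : ℕ} (hmn : m ≠ n) (l : X) :
    inner ℂ (unitSection S m l) (unitSection S n l) = 0 := by
  by_cases hm : m ∈ S l
  · by_cases hn : n ∈ S l
    · rw [inner_unitSection hm, unitSection, dif_pos hn]
      simp [lp.single_apply, hmn]
    · rw [unitSection_of_notMem hn, inner_zero_right]
  · rw [unitSection_of_notMem hm, inner_zero_left]

theorem norm_unitSection_le (S : X → Set ℕ) (n : ℕ) (l : X) : ‖unitSection S n l‖ ≤ 1 := by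
  by_cases h : n ∈ S l
  · rw [@norm_eq_sqrt_re_inner ℂ, inner_unitSection_self h]
    simp
  · simp [unitSection_of_notMem h]

theorem hasSum_inner_unitSection {S : X → Set ℕ} {l : X} (t : SequenceFibre S l) :
    HasSum (fun n => inner ℂ t (unitSection S n l) * inner ℂ (unitSection S n l) t)
      (inner ℂ t t) := by
  have h := lp.hasSum_inner (𝕜 := ℂ) t t
  rw [← hasSum_subtype_iff_of_support_subset (s := S l)]
  · refine Eq.mp (congrArg (HasSum · _) (funext fun i => ?_)) h
    rw [Function.comp_apply, ← inner_conj_symm t, inner_unitSection i.2]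
    simp [Complex.conj_mul']
  · intro n hn
    by_contra h0
    simp [unitSection_of_notMem h0] at hn

theorem eq_zero_of_inner_unitSection {S : X → Set ℕ} {l : X} {t : SequenceFibre S l}
    (h : ∀ n, inner ℂ (unitSection S n l) t = 0) : t = 0 := by
  ext i
  rw [← inner_unitSection i.2, h]
  rfl

theorem aemeasurable_inner_unitSection [MeasurableSpace X] (σ : Measure X) {S : X → Set ℕ}
    (hS : ∀ n, MeasurableSet {l | n ∈ S l}) (m n : ℕ) :
    AEMeasurable (fun l => inner ℂ (unitSection S m l) (unitSection S n l)) σ := by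
  rcases eq_or_ne m n with rfl | hmn
  · have : (fun l => inner ℂ (unitSection S m l) (unitSection S m l)) =
        Set.indicator {l | m ∈ S l} fun _ => (1 : ℂ) := by
      ext l
      by_cases h : m ∈ S l
      · rw [inner_unitSection_self h, Set.indicator_of_mem (by exact h)]
      · rw [unitSection_of_notMem h, inner_zero_left, Set.indicator_of_notMem (by exact h)]
    rw [this]
    exact (measurable_const.indicator (hS m)).aemeasurable
  · simp only [inner_unitSection_of_ne hmn, aemeasurable_const]

/-- The measurable field of sequence spaces supported on a measurable family of subsets of `ℕ`: a
section is measurable when all its coordinates are. -/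
def sequenceField [MeasurableSpace X] (σ : Measure X) {S : X → Set ℕ}
    (hS : ∀ n, MeasurableSet {l | n ∈ S l}) : MeasurableField σ (SequenceFibre S) where
  sections :=
    { carrier := {t | ∀ n, AEMeasurable (fun l => inner ℂ (unitSection S n l) (t l)) σ}
      add_mem' := fun hs ht n => by
        simpa only [Pi.add_apply, inner_add_right] using (hs n).fun_add (ht n)
      zero_mem' := fun n => by simp
      smul_mem' := fun c s hs n => by
        simpa only [Pi.smul_apply, inner_smul_right] using (hs n).const_mul c }
  aemeasurable_norm := fun t ht => by
    -- By Parseval, the squared norm is the sum of the squared moduli of the coordinates.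
    have h : AEMeasurable (fun l => inner ℂ (t l) (t l)) σ := by
      refine aemeasurable_of_tendsto_metrizable_ae Filter.atTop (fun N => ?_)
        (Filter.Eventually.of_forall fun l => (hasSum_inner_unitSection (t l)).tendsto_sum_nat)
      refine Finset.aemeasurable_fun_sum _ fun n _ => ?_
      refine AEMeasurable.mul ?_ (ht n)
      simpa only [Function.comp_def, inner_conj_symm] using
        Complex.continuous_conj.measurable.comp_aemeasurable (ht n)
    simp only [@norm_eq_sqrt_re_inner ℂ]
    exact (Complex.measurable_re.comp_aemeasurable h).sqrt
  mem_of_aemeasurable_inner := fun t ht n => by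
    exact ht _ fun m => aemeasurable_inner_unitSection σ hS m n
  exists_total := by
    refine ⟨unitSection S, fun n m => aemeasurable_inner_unitSection σ hS m n, fun l => ?_⟩
    rw [Submodule.topologicalClosure_eq_top_iff, Submodule.eq_bot_iff]
    exact fun t ht => eq_zero_of_inner_unitSection fun n =>
      Submodule.inner_right_of_mem_orthogonal (Submodule.subset_span (Set.mem_range_self n)) ht

end SequenceField

/-! ### Existence of the spectral decomposition -/

/-- A weighted sum of finite measures is a finite measure dominating all of them and vanishing
on their common null sets. -/
theorem exists_isFiniteMeasure_dominating {X : Type*} [MeasurableSpace X] (μ : ℕ → Measure X)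
    [∀ n, IsFiniteMeasure (μ n)] : ∃ σ : Measure X, IsFiniteMeasure σ ∧ (∀ n, μ n ≪ σ) ∧
      ∀ s, MeasurableSet s → (∀ n, μ n s = 0) → σ s = 0 := by
  obtain ⟨δ, hδ, hsum⟩ := ENNReal.exists_pos_tsum_mul_lt_of_countable one_ne_zero
    (fun n => μ n Set.univ) fun n => measure_ne_top _ _
  refine ⟨Measure.sum fun n => (δ n : ENNReal) • μ n, ⟨?_⟩, fun n => ?_, fun s hs h => ?_⟩
  · rw [Measure.sum_apply _ MeasurableSet.univ]
    refine lt_of_eq_of_lt (tsum_congr fun n => ?_) (hsum.trans ENNReal.one_lt_top)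
    rw [Measure.smul_apply, smul_eq_mul, mul_comm]
  · refine Measure.AbsolutelyContinuous.mk fun s hs h => ?_
    rw [Measure.sum_apply _ hs, ENNReal.tsum_eq_zero] at h
    have := h n
    rw [Measure.smul_apply, smul_eq_mul, mul_eq_zero] at this
    exact this.resolve_left (by exact_mod_cast (hδ n).ne')
  · rw [Measure.sum_apply _ hs, ENNReal.tsum_eq_zero]
    intro n
    rw [Measure.smul_apply, h, smul_zero]

namespace MeasurableField

variable {s : Set ℝ} [CompactSpace s] {σ : Measure s} {K : s → Type v}
  [∀ l, NormedAddCommGroup (K l)] [∀ l, InnerProductSpace ℂ (K l)] {F : MeasurableField σ K}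

theorem pow_smul_mem_squareIntegrable (k : ℕ) {t : ∀ l, K l} (ht : t ∈ F.squareIntegrable) :
    (fun l : s => ((l : ℝ) : ℂ) ^ k • t l) ∈ F.squareIntegrable := by
  obtain ⟨C, hC⟩ := norm_coe_pow_le (s := s) k
  refine mem_squareIntegrable_of_norm_le
    (smul_mem_sections (continuous_coe_pow_complex k).measurable.aemeasurable ht.1)
    (ht.2.const_mul C) (Filter.Eventually.of_forall fun l => ?_)
  rw [norm_smul]
  exact mul_le_mul_of_nonneg_right (hC l) (norm_nonneg _)

end MeasurableField

open MeasurableField in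
/-- On the cyclic subspace of `x n`, with spectral measure `ρ n dσ`, the identification sends
`G ^ k x n` to the section `l ↦ l ^ k √(ρ n l)` times the `n`-th unit vector. -/
theorem exists_spectralDecomposition {H : Type u} [NormedAddCommGroup H] [InnerProductSpace ℂ H]
    [CompleteSpace H] [TopologicalSpace.SeparableSpace H] {G : H →L[ℂ] H}
    (hG : IsSelfAdjoint G) : ∃ D : SpectralDecomposition.{u, 0} G, IsFiniteMeasure D.σ := by
  obtain ⟨x, hx, htot⟩ := exists_orthogonal_cyclic hG
  choose μ hμ using fun n => exists_isSpectralMeasureAt hG (x n)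
  have : ∀ n, IsFiniteMeasure (μ n) := fun n => (hμ n).1
  obtain ⟨σ, hσ, hac, hnull⟩ := exists_isFiniteMeasure_dominating μ
  have hdecomp : ∀ n, (μ n).HaveLebesgueDecomposition σ := fun n =>
    Measure.haveLebesgueDecomposition_of_sigmaFinite (μ n) σ
  let ρ : ℕ → spectrum ℝ G → ENNReal := fun n => (μ n).rnDeriv σ
  have hρ : ∀ n, Measurable (ρ n) := fun n => Measure.measurable_rnDeriv _ _
  have hρtop : ∀ n, ∀ᵐ l ∂σ, ρ n l < ⊤ := fun n => Measure.rnDeriv_lt_top _ _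
  let r : ℕ → spectrum ℝ G → ℝ := fun n l => √(ρ n l).toReal
  have hr : ∀ n, Measurable (r n) := fun n => (hρ n).ennreal_toReal.sqrt
  have hr2 : ∀ n, MemLp (r n) 2 σ := fun n => by
    rw [memLp_two_iff_integrable_sq (hr n).aestronglyMeasurable]
    have : (fun l => r n l ^ 2) = fun l => (ρ n l).toReal :=
      funext fun l => Real.sq_sqrt ENNReal.toReal_nonneg
    rw [this]
    exact Measure.integrable_toReal_rnDeriv
  let S : spectrum ℝ G → Set ℕ := fun l => {n | ρ n l ≠ 0}
  have hS : ∀ n, MeasurableSet {l | n ∈ S l} := fun n =>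
    (hρ n (measurableSet_singleton 0)).compl
  let F := sequenceField σ hS
  have hunit : ∀ n, unitSection S n ∈ F.sections := fun n m =>
    aemeasurable_inner_unitSection σ hS m n
  have hb : ∀ n, (fun l => (r n l : ℂ) • unitSection S n l) ∈ F.squareIntegrable := fun n => by
    refine mem_squareIntegrable_of_norm_le (smul_mem_sections
      (Complex.measurable_ofReal.comp (hr n)).aemeasurable (hunit n)) (hr2 n)
      (Filter.Eventually.of_forall fun l => ?_)
    rw [norm_smul, Complex.norm_real, Real.norm_of_nonneg (Real.sqrt_nonneg _)]
    exact mul_le_of_le_one_right (Real.sqrt_nonneg _) (norm_unitSection_le S n l)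
  have hb' := fun p : ℕ × ℕ => pow_smul_mem_squareIntegrable p.2 (hb p.1)
  let g : ℕ × ℕ → F.DirectIntegral := fun p => toDirect (hb' p)
  have hinner_g : ∀ (p : ℕ × ℕ) (φ : F.DirectIntegral), inner ℂ (g p) φ =
      ∫ l, ((l : ℝ) : ℂ) ^ p.2 * inner ℂ ((r p.1 l : ℂ) • unitSection S p.1 l) (φ.component l) ∂σ :=
    fun p φ => by
      rw [MeasurableField.inner_eq]
      refine integral_congr_ae ?_
      filter_upwards [component_toDirect (hb' p)] with l hl
      rw [hl, inner_smul_left, ← Complex.ofReal_pow, Complex.conj_ofReal]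
  -- Orthogonality to all `g (n, k)` means that `⟪√(ρ n) e n, φ⟫` has vanishing moments.
  have hgzero : ∀ φ : F.DirectIntegral, (∀ p, inner ℂ (g p) φ = 0) → φ = 0 := fun φ h => by
    have h1 : ∀ n, ∀ᵐ l ∂σ,
        inner ℂ ((r n l : ℂ) • unitSection S n l) (φ.component l) = 0 := fun n => by
      refine ae_eq_of_moments_eq (F.integrable_inner
        (⟨_, hb n⟩ : F.squareIntegrable)
        (⟨_, MeasurableField.component_mem φ⟩ : F.squareIntegrable))
        (integrable_zero _ _ _) fun k => ?_
      rw [← hinner_g (n, k), h]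
      simp
    refine MeasurableField.ext_component ?_
    have h0 := MeasurableField.component_smul 0 (0 : F.DirectIntegral)
    filter_upwards [ae_all_iff.2 h1, ae_all_iff.2 hρtop, h0] with l h1 h2 h0
    rw [zero_smul, zero_smul] at h0
    rw [h0]
    refine eq_zero_of_inner_unitSection fun n => ?_
    by_cases hn : n ∈ S l
    · have hrn : (r n l : ℂ) ≠ 0 := Complex.ofReal_ne_zero.2
        (Real.sqrt_pos.2 (ENNReal.toReal_pos hn (h2 n).ne)).ne'
      have := h1 n
      rw [inner_smul_left, Complex.conj_ofReal] at this
      exact (mul_eq_zero.1 this).resolve_left hrn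
    · rw [unitSection_of_notMem hn, inner_zero_left]
  have hgtot : (Submodule.span ℂ (Set.range g)).topologicalClosure = ⊤ := by
    rw [Submodule.topologicalClosure_eq_top_iff, Submodule.eq_bot_iff]
    exact fun φ hφ => hgzero φ fun p =>
      Submodule.inner_right_of_mem_orthogonal (Submodule.subset_span (Set.mem_range_self p)) hφ
  have hgram : ∀ p q : ℕ × ℕ, inner ℂ ((G ^ p.2) (x p.1)) ((G ^ q.2) (x q.1)) =
      inner ℂ (g p) (g q) := fun p q => by
    rw [hG.inner_pow_left, ← mul_apply_eq_comp, ← pow_add, hinner_g]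
    have hq := component_toDirect (hb' q)
    rcases eq_or_ne p.1 q.1 with hpq | hpq
    -- Here `⟪x n, G ^ (j + k) x n⟫` is a moment of the spectral measure `ρ n dσ`.
    · rw [← hpq, ← (hμ p.1).2, ← Measure.withDensity_rnDeriv_eq (μ p.1) σ (hac p.1),
        integral_withDensity_eq_integral_toReal_smul (hρ p.1) (hρtop p.1)]
      refine integral_congr_ae ?_
      filter_upwards [hq] with l hl
      rw [hl, ← hpq, inner_smul_right, inner_smul_left, inner_smul_right, Complex.conj_ofReal]
      by_cases hn : p.1 ∈ S l
      · rw [inner_unitSection_self hn, Complex.real_smul, pow_add, mul_one]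
        have : ((ρ p.1 l).toReal : ℂ) = r p.1 l * r p.1 l := by
          rw [← Complex.ofReal_mul, Real.mul_self_sqrt ENNReal.toReal_nonneg]
        change ((ρ p.1 l).toReal : ℂ) * _ = _
        rw [this]
        ring
      · have h0 : ρ p.1 l = 0 := not_not.1 hn
        change (ρ p.1 l).toReal • _ = _
        rw [unitSection_of_notMem hn, h0]
        simp
    · rw [hx _ _ hpq, eq_comm, ← integral_zero (spectrum ℝ G) ℂ (μ := σ)]
      refine integral_congr_ae ?_
      filter_upwards [hq] with l hl
      rw [hl, inner_smul_right, inner_smul_left, inner_smul_right,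
        inner_unitSection_of_ne hpq]
      simp
  obtain ⟨W, hW⟩ := exists_linearIsometryEquiv_of_inner_eq htot hgtot hgram
  have hmul : ∀ φ, ∀ᵐ l ∂σ, (W (G φ)).component l = ((l : ℝ) : ℂ) • (W φ).component l :=
    fun φ => by
      have hm := pow_smul_mem_squareIntegrable 1 (MeasurableField.component_mem (W φ))
      -- Both sides have the same inner products with the total family `g`.
      have heq : W (G φ) = toDirect hm := by
        refine sub_eq_zero.1 (hgzero _ fun p => sub_eq_zero.1 ?_)
        rw [inner_sub_right, sub_zero, sub_eq_zero]
        have e1 : inner ℂ (g p) (W (G φ)) = inner ℂ (g (p.1, p.2 + 1)) (W φ) := by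
          rw [← hW, ← hW, W.inner_map_map, W.inner_map_map, hG.inner_pow_left, hG.inner_pow_left,
            pow_succ, mul_apply_eq_comp]
        rw [e1, hinner_g, hinner_g]
        refine integral_congr_ae ?_
        filter_upwards [component_toDirect hm] with l hl
        rw [hl, inner_smul_right, pow_one, pow_succ, mul_assoc]
      filter_upwards [component_toDirect hm] with l hl
      rw [heq, hl, pow_one]
  have hnt : ∀ᵐ l ∂σ, Nontrivial (SequenceFibre S l) := by
    -- On a set where all densities vanish all the spectral measures vanish, hence so does `σ`.
    have hne : ∀ᵐ l ∂σ, ∃ n, ρ n l ≠ 0 := by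
      rw [ae_iff]
      have hset : {l | ¬∃ n, ρ n l ≠ 0} = ⋂ n, ρ n ⁻¹' {0} := by
        ext l
        simp
      have hms : MeasurableSet (⋂ n, ρ n ⁻¹' {0}) :=
        MeasurableSet.iInter fun n => hρ n (measurableSet_singleton 0)
      rw [hset]
      refine hnull _ hms fun n => ?_
      rw [← Measure.withDensity_rnDeriv_eq (μ n) σ (hac n), withDensity_apply _ hms,
        setLIntegral_eq_zero_iff hms (hρ n)]
      exact Filter.Eventually.of_forall fun l hl => Set.mem_iInter.1 hl n
    filter_upwards [hne] with l ⟨n, hn⟩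
    refine ⟨unitSection S n l, 0, fun h => ?_⟩
    have := inner_unitSection_self (S := S) (l := l) hn
    rw [h, inner_zero_left] at this
    exact zero_ne_one this
  exact ⟨{ σ := σ, sigmaFinite := inferInstance, K := SequenceFibre S, nontrivial := hnt,
           field := F, W := W, mul_apply := hmul }, hσ⟩

end

theorem mainTheorem2 {H : Type u} [NormedAddCommGroup H] [InnerProductSpace ℂ H] [CompleteSpace H]
    [TopologicalSpace.SeparableSpace H] (h₂ : HermitianStructure H) (G : H →L[ℂ] H)
    (hG : ∀ x y, h₂.form x y = inner ℂ (G x) y) :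
    G.IsPositive ∧
    (∃ D : SpectralDecomposition.{u, 0} G, IsFiniteMeasure D.σ) ∧
    ∀ D : SpectralDecomposition.{u, v} G,
      (∀ U : H →L[ℂ] H, IsBiUnitary h₂ U ↔
        ∃ V : ∀ l, D.K l ≃ₗᵢ[ℂ] D.K l, D.field.IsMeasurableUnitaryField V ∧ D.IsDecomposed V U) ∧
      (∀ V : ∀ l, D.K l ≃ₗᵢ[ℂ] D.K l, D.field.IsMeasurableUnitaryField V →
        ∃ U : H →L[ℂ] H, D.IsDecomposed V U) ∧
      (IsCyclicOperator G →
        (∀ᵐ l ∂D.σ, Module.finrank ℂ (D.K l) = 1) ∧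
        (∀ U : H →L[ℂ] H, IsBiUnitary h₂ U ↔
          ∃ θ : spectrum ℝ G → ℝ, AEMeasurable θ D.σ ∧ D.IsPhaseMultiplication θ U) ∧
        (∀ U : H →L[ℂ] H, IsBiUnitary h₂ U ↔
          ∃ θ : spectrum ℝ G → ℝ, AEMeasurable θ D.σ ∧
            IsFunctionOf G (fun l => Complex.exp (Complex.I * θ l)) U) ∧
        (∀ θ : spectrum ℝ G → ℝ, AEMeasurable θ D.σ →
          ∃ U : H →L[ℂ] H, D.IsPhaseMultiplication θ U ∧
            IsFunctionOf G (fun l => Complex.exp (Complex.I * θ l)) U)) := by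
  refine ⟨isPositive_of_form_eq hG,
    exists_spectralDecomposition (isPositive_of_form_eq hG).isSelfAdjoint, fun D => ?_⟩
  have hphase : IsCyclicOperator G → ∀ U : H →L[ℂ] H, IsBiUnitary h₂ U ↔
      ∃ θ : spectrum ℝ G → ℝ, AEMeasurable θ D.σ ∧ D.IsPhaseMultiplication θ U := by
    refine fun hcyc U => ⟨fun hU => ?_, fun ⟨θ, hθ, hU⟩ => ?_⟩
    · obtain ⟨V, -, hdec⟩ := hU.exists_isDecomposed hG D
      exact hdec.exists_isPhaseMultiplication hcyc
    · exact SpectralDecomposition.IsDecomposed.isBiUnitary hG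
        (SpectralDecomposition.isMeasurableUnitaryField_phaseEquiv hθ)
        (SpectralDecomposition.isPhaseMultiplication_iff.1 hU)
  refine ⟨fun U => ⟨fun hU => hU.exists_isDecomposed hG D, fun ⟨V, hV, hdec⟩ =>
    hdec.isBiUnitary hG hV⟩, fun V hV => SpectralDecomposition.exists_isDecomposed hV,
    fun hcyc => ⟨D.finrank_eq_one_of_cyclic hcyc, hphase hcyc, fun U => ?_, fun θ hθ => ?_⟩⟩
  · rw [hphase hcyc]
    exact exists_congr fun θ => and_congr_right fun hθ => ⟨fun hU => hU.isFunctionOf hθ,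
      SpectralDecomposition.isPhaseMultiplication_of_isFunctionOf hθ⟩
  · obtain ⟨U, hU⟩ := SpectralDecomposition.exists_isPhaseMultiplication hθ
    exact ⟨U, hU, hU.isFunctionOf hθ⟩
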